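/- Conventions. An operator algebra is a (not necessarily closed, unital or self-adjoint) complex subalgebra $\mathcal A\subseteq B(\mathcal H)$, $\mathcal H$ a complex Hilbert space; $\mathbb M_n(\mathcal A)$ carries the norm of $B(\mathcal H^n)$. A representation of $\mathcal A$ is a completely contractive algebra homomorphism $\rho:\mathcal A\to B(\mathcal K)$, $\mathcal K$ a Hilbert space. $\mathcal A$ is residually finite-dimensional (RFD) if there is a completely isometric homomorphism $\mathcal A\to\prod_{\lambda}\mathbb M_{r_\lambda}$ for some family of positive integers $r_\lambda$; for a $\mathrm C^*$-algebra this means that it has an injective $*$-homomorphism into such a product. A $\mathrm C^*$-cover of $\mathcal A$ is a pair $(\mathfrak A,\iota)$ with $\iota:\mathcal A\to B(\mathcal K)$ a completely isometric homomorphism and $\mathfrak A=\mathrm C^*(\iota(\mathcal A))$. Write $(\mathfrak A,\iota)\preceq(\mathfrak B,j)$ if there is a surjective $*$-homomorphism $\pi:\mathfrak B\to\mathfrak A$ with $\pi\circ j=\iota$. A maximal $\mathrm C^*$-cover $(\mathrm C^*_{max}(\mathcal A),\mu)$ is a $\mathrm C^*$-cover such that every representation $\rho$ of $\mathcal A$ is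 $\theta\circ\mu$ for a unique $*$-representation $\theta$ of $\mathrm C^*_{max}(\mathcal A)$. An RFD-maximal $\mathrm C^*$-cover $(\mathfrak R(\mathcal A),\upsilon)$ is a $\mathrm C^*$-cover that is maximal for $\preceq$ (up to equivalence) among the $\mathrm C^*$-covers $(\mathfrak A,\iota)$ with $\mathfrak A$ RFD. The spectrum $\widehat{\mathfrak A}$ of a $\mathrm C^*$-algebra is the set of unitary equivalence classes of its irreducible $*$-representations, with the weakest topology making $[\pi]\mapsto\ker\pi$ continuous for the hull-kernel topology on the primitive ideals. Theorem 4.4. Let $\mathcal A$ be an RFD operator algebra. Then a maximal $\mathrm C^*$-cover and an RFD-maximal $\mathrm C^*$-cover of $\mathcal A$ exist. For any maximal $\mathrm C^*$-cover $(\mathrm C^*_{max}(\mathcal A),\mu)$ and any RFD-maximal $\mathrm C^*$-cover $(\mathfrak R(\mathcal A),\upsilon)$ there is a unique $*$-homomorphism $q:\mathrm C^*_{max}(\mathcal A)\to\mathfrak R(\mathcal A)$ with $q\circ\mu=\upsilon$, and it is surjective. Let $\mathfrak J=\ker q$, and let $\mathcal S(\mathfrak R(\mathcal A),\upsilon)\subseteq\widehat{\mathrm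 C^*_{max}(\mathcal A)}$ be the set of classes of irreducible $*$-representations of the form $\sigma\circ q$ with $\sigma$ an irreducible $*$-representation of $\mathfrak R(\mathcal A)$. Then: (i) $\mathcal S(\mathfrak R(\mathcal A),\upsilon)$ is the closure in $\widehat{\mathrm C^*_{max}(\mathcal A)}$ of the set of all equivalence classes of finite-dimensional irreducible $*$-representations of $\mathrm C^*_{max}(\mathcal A)$; (ii) $\mathfrak J$ has no nonzero finite-dimensional $*$-representation, that is, every $*$-homomorphism from $\mathfrak J$ to $B(\mathcal K)$ with $\mathcal K$ a finite-dimensional Hilbert space is zero; (iii) among the closed subsets of $\widehat{\mathrm C^*_{max}(\mathcal A)}$ that have a dense subset of equivalence classes of finite-dimensional irreducible $*$-representations, $\mathcal S(\mathfrak R(\mathcal A),\upsilon)$ is the largest, and it is the only maximal one. -/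

import Mathlib

universe u

namespace OpAlg

noncomputable section

/-! ### Operator matrices, representations, residual finite-dimensionality -/

/-- The operator on the Hilbert space `Kⁿ` (`ℓ²`-direct sum of `n` copies of `K`) given by an
`n × n` matrix of operators on `K`: `(x_j)_j ↦ (∑ j, T i j x_j)_i`. -/
def opMatrix {K : Type*} [NormedAddCommGroup K] [InnerProductSpace ℂ K] {n : ℕ}
    (T : Matrix (Fin n) (Fin n) (K →L[ℂ] K)) :
    PiLp 2 (fun _ : Fin n => K) →L[ℂ] PiLp 2 (fun _ : Fin n => K) :=
  ((PiLp.continuousLinearEquiv 2 ℂ (fun _ : Fin n => K)).symm :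
      (Fin n → K) →L[ℂ] PiLp 2 (fun _ : Fin n => K)) ∘L
    ContinuousLinearMap.pi fun i => ∑ j, (T i j) ∘L PiLp.proj 2 (fun _ : Fin n => K) j

section Representations

variable {H : Type*} [NormedAddCommGroup H] [InnerProductSpace ℂ H]
  {K : Type*} [NormedAddCommGroup K] [InnerProductSpace ℂ K]

/-- The norm of a matrix over an operator algebra `A ⊆ B(H)`, computed in `B(Hⁿ)`. -/
def matrixNorm (A : NonUnitalSubalgebra ℂ (H →L[ℂ] H)) {n : ℕ}
    (M : Matrix (Fin n) (Fin n) A) : ℝ :=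
  ‖opMatrix (M.map fun a => (a : H →L[ℂ] H))‖

/-- A completely contractive homomorphism, that is, a representation of `A` on `K`. -/
def IsCompletelyContractive {A : NonUnitalSubalgebra ℂ (H →L[ℂ] H)}
    (ρ : A →ₙₐ[ℂ] (K →L[ℂ] K)) : Prop :=
  ∀ (n : ℕ) (M : Matrix (Fin n) (Fin n) A), ‖opMatrix (M.map ρ)‖ ≤ matrixNorm A M

/-- A completely isometric homomorphism. -/
def IsCompletelyIsometric {A : NonUnitalSubalgebra ℂ (H →L[ℂ] H)}
    (ρ : A →ₙₐ[ℂ] (K →L[ℂ] K)) : Prop :=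
  ∀ (n : ℕ) (M : Matrix (Fin n) (Fin n) A), ‖opMatrix (M.map ρ)‖ = matrixNorm A M

end Representations

/-- An operator algebra is residually finite-dimensional if it embeds completely isometrically
into a product of full matrix algebras: there is a family of representations on the spaces
`ℂ^(r l)` which computes the norm of every matrix over `A`. -/
def IsRFD {H : Type u} [NormedAddCommGroup H] [InnerProductSpace ℂ H]
    (A : NonUnitalSubalgebra ℂ (H →L[ℂ] H)) : Prop :=
  ∃ (Λ : Type u) (r : Λ → ℕ)
    (ρ : ∀ l : Λ, A →ₙₐ[ℂ] (EuclideanSpace ℂ (Fin (r l)) →L[ℂ] EuclideanSpace ℂ (Fin (r l)))),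
    (∀ l, 0 < r l) ∧ (∀ l, IsCompletelyContractive (ρ l)) ∧
    ∀ (n : ℕ) (M : Matrix (Fin n) (Fin n) A),
      matrixNorm A M = ⨆ l, ‖opMatrix (M.map (ρ l))‖

/-- A `C*`-algebra is residually finite-dimensional if it admits an injective (hence completely
isometric) `*`-homomorphism into a product of full matrix algebras. -/
def IsRFDCStar (B : Type u) [NonUnitalCStarAlgebra B] : Prop :=
  ∃ (Λ : Type u) (r : Λ → ℕ)
    (π : ∀ l : Λ, B →⋆ₙₐ[ℂ] (EuclideanSpace ℂ (Fin (r l)) →L[ℂ] EuclideanSpace ℂ (Fin (r l)))),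
    (∀ l, 0 < r l) ∧ ∀ b : B, (∀ l, π l b = 0) → b = 0

/-! ### The spectrum of a `C*`-algebra -/

/-- A `*`-representation is irreducible if it is nonzero and has no closed invariant subspaces
other than `0` and the whole space. -/
def IsIrreducible {B : Type*} [NonUnitalCStarAlgebra B]
    {K : Type*} [NormedAddCommGroup K] [InnerProductSpace ℂ K] [CompleteSpace K]
    (π : B →⋆ₙₐ[ℂ] (K →L[ℂ] K)) : Prop :=
  π ≠ 0 ∧ ∀ W : Submodule ℂ K, IsClosed (W : Set K) →
    (∀ b : B, ∀ x ∈ W, π b x ∈ W) → W = ⊥ ∨ W = ⊤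

/-- An irreducible `*`-representation of `B`, together with its Hilbert space. -/
structure Irrep (B : Type u) [NonUnitalCStarAlgebra B] where
  /-- the Hilbert space -/
  K : Type u
  [normed : NormedAddCommGroup K]
  [inner : InnerProductSpace ℂ K]
  [complete : CompleteSpace K]
  /-- the representation -/
  rep : B →⋆ₙₐ[ℂ] (K →L[ℂ] K)
  irreducible : IsIrreducible rep

attribute [instance] Irrep.normed Irrep.inner Irrep.complete

variable {B : Type u} [NonUnitalCStarAlgebra B]

/-- Unitary equivalence. -/
def Irrep.UnitaryEquiv (π σ : Irrep B) : Prop :=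
  ∃ U : π.K ≃ₗᵢ[ℂ] σ.K, ∀ (b : B) (x : π.K), U (π.rep b x) = σ.rep b (U x)

instance irrepSetoid (B : Type u) [NonUnitalCStarAlgebra B] : Setoid (Irrep B) where
  r := Irrep.UnitaryEquiv
  iseqv :=
    { refl := fun _ => ⟨LinearIsometryEquiv.refl ℂ _, fun _ _ => rfl⟩
      symm := by
        rintro π σ ⟨U, hU⟩
        refine ⟨U.symm, fun b x => ?_⟩
        rw [LinearIsometryEquiv.symm_apply_eq, hU, LinearIsometryEquiv.apply_symm_apply]
      trans := by
        rintro π σ τ ⟨U, hU⟩ ⟨V, hV⟩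
        refine ⟨U.trans V, fun b x => ?_⟩
        simp only [LinearIsometryEquiv.trans_apply]
        rw [hU, hV] }

/-- The spectrum of `B`: unitary equivalence classes of irreducible `*`-representations. -/
def Spec (B : Type u) [NonUnitalCStarAlgebra B] : Type (u + 1) := Quotient (irrepSetoid B)

/-- The class of an irreducible `*`-representation. -/
def Irrep.cls (π : Irrep B) : Spec B := Quotient.mk (irrepSetoid B) π

/-- The primitive ideal space: kernels of irreducible `*`-representations. -/
def PrimitiveIdeals (B : Type u) [NonUnitalCStarAlgebra B] : Type u :=
  {I : TwoSidedIdeal B // ∃ π : Irrep B, I = TwoSidedIdeal.ker π.rep}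

/-- The hull of a set `S ⊆ B`: all primitive ideals containing `S`. -/
def hull (S : Set B) : Set (PrimitiveIdeals B) := {P | ∀ b ∈ S, b ∈ P.1}

/-- Primitive ideals are prime. -/
theorem exists_mul_notMem_of_notMem (P : PrimitiveIdeals B) {s t : B}
    (hs : s ∉ P.1) (ht : t ∉ P.1) : ∃ b : B, s * b * t ∉ P.1 := by
  obtain ⟨I, π, rfl⟩ := P
  by_contra! hcon
  simp only [TwoSidedIdeal.mem_ker] at hs ht hcon
  obtain ⟨hne, hirr⟩ := π.irreducible
  obtain ⟨v, hv⟩ : ∃ v, π.rep t v ≠ 0 := by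
    by_contra! h
    exact ht (ContinuousLinearMap.ext h)
  -- all vectors that are annihilated by `π (s * b)` for every `b`, and by `π s`
  let W : Submodule ℂ π.K :=
    (π.rep s : π.K →ₗ[ℂ] π.K).ker ⊓ ⨅ b : B, (π.rep (s * b) : π.K →ₗ[ℂ] π.K).ker
  have memW : ∀ x, x ∈ W ↔ π.rep s x = 0 ∧ ∀ b, π.rep (s * b) x = 0 := by
    intro x; simp [W]
  have hWc : IsClosed (W : Set π.K) := by
    have : (W : Set π.K) = {x | π.rep s x = 0} ∩ ⋂ b : B, {x | π.rep (s * b) x = 0} := by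
      ext x
      simp only [SetLike.mem_coe, memW, Set.mem_inter_iff, Set.mem_ofPred_eq, Set.mem_iInter]
    rw [this]
    exact (isClosed_eq (π.rep s).continuous continuous_const).inter
      (isClosed_iInter fun b => isClosed_eq (π.rep (s * b)).continuous continuous_const)
  have hWi : ∀ b : B, ∀ x ∈ W, π.rep b x ∈ W := by
    intro b x hx
    rw [memW] at hx ⊢
    refine ⟨?_, fun c => ?_⟩
    · have := hx.2 b
      rwa [map_mul] at this
    · have := hx.2 (c * b)
      rwa [← mul_assoc, map_mul] at this
  rcases hirr W hWc hWi with h | h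
  · -- then `π b (π t v) = 0` for all `b`, so the line through `π t v` is invariant
    have hzero : ∀ b, π.rep b (π.rep t v) = 0 := by
      intro b
      have : π.rep b (π.rep t v) ∈ W := by
        rw [memW]
        refine ⟨?_, fun c => ?_⟩
        · have := congrArg (fun T : π.K →L[ℂ] π.K => T v) (hcon b)
          simpa [map_mul] using this
        · have := congrArg (fun T : π.K →L[ℂ] π.K => T v) (hcon (c * b))
          simpa [map_mul] using this
      rw [h] at this
      simpa using this
    rcases hirr (ℂ ∙ π.rep t v) (Submodule.closed_of_finiteDimensional _) (by
        intro b x hx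
        obtain ⟨c, rfl⟩ := Submodule.mem_span_singleton.1 hx
        simp [hzero]) with h' | h'
    · exact hv (by simpa using h')
    · apply hne
      ext b x
      have hx : x ∈ (ℂ ∙ π.rep t v) := by rw [h']; trivial
      obtain ⟨c, rfl⟩ := Submodule.mem_span_singleton.1 hx
      simp [hzero]
  · apply hs
    ext x
    have hx : x ∈ W := by rw [h]; trivial
    exact ((memW x).1 hx).1

/-- The hull-kernel topology: the closed sets are the hulls. -/
instance : TopologicalSpace (PrimitiveIdeals B) :=
  TopologicalSpace.ofClosed {Z | ∃ S : Set B, Z = hull S}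
    ⟨Set.univ, by
      ext P
      simp only [hull, Set.mem_empty_iff_false, Set.mem_ofPred_eq, false_iff]
      intro h
      obtain ⟨I, π, rfl⟩ := P
      apply π.irreducible.1
      ext b x
      have := h b (Set.mem_univ b)
      rw [TwoSidedIdeal.mem_ker] at this
      simp [this]⟩
    (by
      intro 𝒵 h𝒵
      refine ⟨{b | ∃ S : Set B, hull S ∈ 𝒵 ∧ b ∈ S}, ?_⟩
      ext P
      constructor
      · rintro h b ⟨S, hS, hb⟩
        exact h _ hS b hb
      · intro h Z hZ
        obtain ⟨S, rfl⟩ := h𝒵 hZ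
        exact fun b hb => h b ⟨S, hZ, hb⟩)
    (by
      rintro _ ⟨S, rfl⟩ _ ⟨T, rfl⟩
      refine ⟨{c | ∃ s ∈ S, ∃ b : B, ∃ t ∈ T, c = s * b * t}, ?_⟩
      ext P
      constructor
      · rintro (h | h)
        · rintro _ ⟨s, hs, b, t, ht, rfl⟩
          exact P.1.mul_mem_right _ _ (P.1.mul_mem_right _ _ (h s hs))
        · rintro _ ⟨s, hs, b, t, ht, rfl⟩
          exact P.1.mul_mem_left _ _ (h t ht)
      · intro h
        by_contra hc
        simp only [hull, Set.mem_union, Set.mem_ofPred_eq, not_or, not_forall] at hc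
        obtain ⟨⟨s, hs, hsP⟩, ⟨t, ht, htP⟩⟩ := hc
        obtain ⟨b, hb⟩ := exists_mul_notMem_of_notMem P hsP htP
        exact hb (h _ ⟨s, hs, b, t, ht, rfl⟩))

/-- The map `[π] ↦ ker π`. -/
def Spec.ker : Spec B → PrimitiveIdeals B :=
  Quotient.lift (fun π : Irrep B => ⟨TwoSidedIdeal.ker π.rep, π, rfl⟩) (by
    rintro π σ ⟨U, hU⟩
    apply Subtype.ext
    apply TwoSidedIdeal.ext
    intro b
    simp only [TwoSidedIdeal.mem_ker]
    constructor
    · intro h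
      ext x
      have := hU b (U.symm x)
      rw [h] at this
      simpa using this.symm
    · intro h
      ext x
      have := hU b x
      rw [h] at this
      simpa using this)

/-- The weakest topology for which `[π] ↦ ker π` is continuous. -/
instance : TopologicalSpace (Spec B) := TopologicalSpace.induced Spec.ker inferInstance

/-- The classes of the finite-dimensional irreducible `*`-representations. -/
def finDimClasses (B : Type u) [NonUnitalCStarAlgebra B] : Set (Spec B) :=
  {x | ∃ π : Irrep B, FiniteDimensional ℂ π.K ∧ π.cls = x}

/-- `C` has a dense subset consisting of classes of finite-dimensional representations. -/
def HasDenseFinDim (C : Set (Spec B)) : Prop :=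
  ∃ D ⊆ C, D ⊆ finDimClasses B ∧ C ⊆ closure D

/-- The kernel of a `*`-homomorphism, as a (non-unital) `*`-algebra. -/
def kerStar {B C : Type*} [NonUnitalCStarAlgebra B] [NonUnitalCStarAlgebra C]
    (q : B →⋆ₙₐ[ℂ] C) : NonUnitalStarSubalgebra ℂ B where
  carrier := {b | q b = 0}
  add_mem' := by intro a b ha hb; simp_all
  zero_mem' := by simp
  mul_mem' := by intro a b ha hb; simp_all
  smul_mem' := by intro c b hb; simp_all
  star_mem' := by intro b hb; simp_all [map_star]

/-! ### `C*`-covers -/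

section Covers

variable {H : Type u} [NormedAddCommGroup H] [InnerProductSpace ℂ H]

/-- A `C*`-cover `(C*(ι(A)), ι)` of the operator algebra `A`, given by a completely isometric
representation `ι` of `A` on a Hilbert space `K`. -/
structure CStarCover (A : NonUnitalSubalgebra ℂ (H →L[ℂ] H)) where
  /-- the Hilbert space -/
  K : Type u
  [normed : NormedAddCommGroup K]
  [inner : InnerProductSpace ℂ K]
  [complete : CompleteSpace K]
  /-- the completely isometric representation -/
  ι : A →ₙₐ[ℂ] (K →L[ℂ] K)
  isometric : IsCompletelyIsometric ι

attribute [instance] CStarCover.normed CStarCover.inner CStarCover.complete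

namespace CStarCover

variable {A : NonUnitalSubalgebra ℂ (H →L[ℂ] H)}

/-- The `C*`-algebra `C*(ι(A))`: the norm closed `*`-subalgebra of `B(K)` generated by `ι(A)`. -/
def alg (C : CStarCover A) : NonUnitalStarSubalgebra ℂ (C.K →L[ℂ] C.K) :=
  (NonUnitalStarAlgebra.adjoin ℂ (Set.range C.ι)).topologicalClosure

instance (C : CStarCover A) : NonUnitalCStarAlgebra C.alg :=
  NonUnitalStarSubalgebra.nonUnitalCStarAlgebra C.alg
    (h_closed := NonUnitalStarSubalgebra.isClosed_topologicalClosure _)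

/-- `ι` as a map from `A` to `C*(ι(A))`. -/
def emb (C : CStarCover A) (a : A) : C.alg :=
  ⟨C.ι a, NonUnitalStarSubalgebra.le_topologicalClosure _
    (NonUnitalStarAlgebra.subset_adjoin ℂ _ (Set.mem_range_self a))⟩

/-- The ordering of covers: `C ≼ D` if there is a surjective `*`-homomorphism `π` from the
algebra of `D` to that of `C` which intertwines the embeddings of `A`. -/
def Below (C D : CStarCover A) : Prop :=
  ∃ π : D.alg →⋆ₙₐ[ℂ] C.alg, Function.Surjective π ∧ ∀ a : A, π (D.emb a) = C.emb a

/-- `(C*(μ(A)), μ)` is the maximal `C*`-cover: every representation of `A` extends uniquely to a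
`*`-representation. -/
def IsMax (M : CStarCover A) : Prop :=
  ∀ (K : Type u) [NormedAddCommGroup K] [InnerProductSpace ℂ K] [CompleteSpace K]
    (ρ : A →ₙₐ[ℂ] (K →L[ℂ] K)), IsCompletelyContractive ρ →
    ∃! θ : M.alg →⋆ₙₐ[ℂ] (K →L[ℂ] K), ∀ a : A, θ (M.emb a) = ρ a

/-- `R` is an RFD-maximal `C*`-cover: its algebra is RFD, and it is maximal among the covers with
that property (maximal for the preorder `≼`, so that its equivalence class is maximal). -/
def IsRFDMax (R : CStarCover A) : Prop :=
  IsRFDCStar R.alg ∧ ∀ C : CStarCover A, IsRFDCStar C.alg → R.Below C → C.Below R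

/-- The spectrum of the cover `R` inside the spectrum of the cover `M`, along
`q : C*(μ(A)) → C*(ι(A))`: the classes of irreducible `*`-representations of the form `σ ∘ q`,
with `σ` an irreducible `*`-representation. -/
def spectrumIn {M R : CStarCover A} (q : M.alg →⋆ₙₐ[ℂ] R.alg) : Set (Spec M.alg) :=
  {x | ∃ π : Irrep M.alg, π.cls = x ∧
    ∃ σ : R.alg →⋆ₙₐ[ℂ] (π.K →L[ℂ] π.K), IsIrreducible σ ∧ π.rep = σ.comp q}

end CStarCover

end Covers

end

end OpAlg

open OpAlg

/-! A cover is determined, up to equivalence, by the seminorm `t ↦ ‖t.eval C.ι‖` on formal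
`*`-polynomials in the elements of `A`, and the order of covers is the pointwise order of these
seminorms (`below_iff`). Direct sums of representations realise suprema of seminorms. Summing enough
representations to reach the universal seminorm gives the maximal cover; summing all
finite-dimensional ones gives `finDimCover`, which is completely isometric because `A` is RFD.

Every RFD cover lies below `finDimCover`, so an RFD-maximal cover `R` is equivalent to it and
dominates every finite-dimensional representation of `A` (`IsRFDMax.finDimDominates`). Hence each
finite-dimensional `*`-representation of the maximal cover factors through `q` and kills `ker q`
(`FinDimDominates.apply_eq_zero`). Since `R.alg` is RFD, `ker q` is exactly the common kernel of the
finite-dimensional irreducible representations. The spectrum of `R` is the hull of `ker q`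
(`mem_spectrumIn_iff`), that is, the hull-kernel closure of the finite-dimensional classes: this is
(i), and (iii) is then formal. For (ii), a finite-dimensional representation of the ideal `ker q`
extends to the whole algebra (`exists_extension_of_kerStar`), and the extension kills `ker q`. -/

namespace OpAlg

noncomputable section

/-! ### Ranges of `*`-homomorphisms -/

section Range

variable {E F : Type*} [NonUnitalCStarAlgebra E] [NonUnitalCStarAlgebra F]

theorem continuous_starHom (φ : E →⋆ₙₐ[ℂ] F) : Continuous φ :=
  AddMonoidHomClass.continuous_of_bound φ 1
    (by simpa only [one_mul] using NonUnitalStarAlgHom.norm_apply_le φ)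

/-- A self-adjoint element in the range of a `*`-homomorphism has a preimage of no larger norm. -/
theorem exists_preimage_norm_le_of_isSelfAdjoint (φ : E →⋆ₙₐ[ℂ] F) (x : E)
    (hx : IsSelfAdjoint (φ x)) : ∃ y, φ y = φ x ∧ ‖y‖ ≤ ‖φ x‖ := by
  set d := φ x with hd
  set x' : E := (realPart x : E) with hx'
  have hsa : IsSelfAdjoint x' := (realPart x).2
  have hφx' : φ x' = d := by
    rw [hx', realPart_apply_coe, map_real_smul φ (continuous_starHom φ), map_add, map_star, ← hd,
      hx.star_eq,
      ← two_smul ℝ d, smul_smul]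
    norm_num
  -- Truncation at height `‖d‖` fixes the spectrum of `d`, so `g` of the self-adjoint lift `x'`
  -- still maps to `d`, while its norm drops to at most `‖d‖`.
  let g : ℝ → ℝ := fun t => max (-‖d‖) (min t ‖d‖)
  have hg0 : g 0 = 0 := by simp [g]
  have hgc : Continuous g := by fun_prop
  refine ⟨cfcₙ g x', ?_, norm_cfcₙ_le fun t _ => ?_⟩
  · rw [NonUnitalStarAlgHom.map_cfcₙ φ g x' hgc.continuousOn hg0 (continuous_starHom φ) hsa
      (hφx' ▸ hx), hφx']
    calc cfcₙ g d = cfcₙ id d := by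
          refine cfcₙ_congr fun t ht => ?_
          have h1 : ‖t‖ ≤ ‖d‖ := by
            simpa [cfcₙ_id ℝ d] using norm_apply_le_norm_cfcₙ (𝕜 := ℝ) id d ht
          rw [Real.norm_eq_abs, abs_le] at h1
          simp [g, h1.1, h1.2]
      _ = d := cfcₙ_id ℝ d
  · rw [Real.norm_eq_abs, abs_le]
    refine ⟨le_max_left _ _, max_le ?_ (min_le_right _ _)⟩
    linarith [norm_nonneg d]

/-- Real and imaginary parts are lifted separately, whence the factor 2. Any uniform constant would
do for the closed range theorem below. -/
theorem exists_preimage_norm_le (φ : E →⋆ₙₐ[ℂ] F) (x : E) :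
    ∃ y, φ y = φ x ∧ ‖y‖ ≤ 2 * ‖φ x‖ := by
  have hre : φ (realPart x : E) = (realPart (φ x) : F) := by
    simp only [realPart_apply_coe, map_real_smul φ (continuous_starHom φ), map_add, map_star]
  have him : φ (imaginaryPart x : E) = (imaginaryPart (φ x) : F) := by
    simp only [imaginaryPart_apply_coe, map_smul, map_real_smul φ (continuous_starHom φ), map_sub,
      map_star]
  obtain ⟨y, hy, hyn⟩ := exists_preimage_norm_le_of_isSelfAdjoint φ (realPart x : E)
    (hre ▸ (realPart (φ x)).2)
  obtain ⟨z, hz, hzn⟩ := exists_preimage_norm_le_of_isSelfAdjoint φ (imaginaryPart x : E)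
    (him ▸ (imaginaryPart (φ x)).2)
  refine ⟨y + Complex.I • z, ?_, ?_⟩
  · rw [map_add, map_smul, hy, hz, hre, him, realPart_add_I_smul_imaginaryPart]
  · have h1 : ‖φ (realPart x : E)‖ ≤ ‖φ x‖ := by rw [hre]; exact realPart.norm_le (φ x)
    have h2 : ‖φ (imaginaryPart x : E)‖ ≤ ‖φ x‖ := by rw [him]; exact imaginaryPart.norm_le (φ x)
    calc ‖y + Complex.I • z‖ ≤ ‖y‖ + ‖Complex.I • z‖ := norm_add_le _ _
      _ = ‖y‖ + ‖z‖ := by rw [norm_smul, Complex.norm_I, one_mul]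
      _ ≤ 2 * ‖φ x‖ := by linarith

/-- The range of a `*`-homomorphism between `C*`-algebras is closed. -/
theorem isClosed_range_starHom (φ : E →⋆ₙₐ[ℂ] F) : IsClosed (Set.range φ) := by
  let f : NormedAddGroupHom E F :=
    (φ : E →+ F).mkNormedAddGroupHom 1 (by simpa using NonUnitalStarAlgHom.norm_apply_le φ)
  let K : AddSubgroup F := (φ : E →+ F).range
  have hK : f.SurjectiveOnWith K 2 := by
    rintro _ ⟨x, rfl⟩
    exact exists_preimage_norm_le φ x
  have := controlled_closure_of_complete two_pos one_pos hK
  rw [← closure_subset_iff_isClosed]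
  intro y hy
  obtain ⟨x, hx, -⟩ := this y hy
  exact ⟨x, hx⟩

end Range

/-! ### Generators of `C*`-algebras and `*`-polynomials -/

/-- Formal `*`-polynomials without constant term, in variables from `A`. -/
inductive StarTerm (A : Type u) : Type u
  | zero : StarTerm A
  | of : A → StarTerm A
  | add : StarTerm A → StarTerm A → StarTerm A
  | mul : StarTerm A → StarTerm A → StarTerm A
  | smul : ℂ → StarTerm A → StarTerm A
  | star : StarTerm A → StarTerm A

namespace StarTerm

variable {A : Type u}

/-- The value of a `*`-polynomial. -/
def eval {E : Type*} [NonUnitalCStarAlgebra E] (κ : A → E) : StarTerm A → E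
  | zero => 0
  | of a => κ a
  | add s t => eval κ s + eval κ t
  | mul s t => eval κ s * eval κ t
  | smul c t => c • eval κ t
  | star t => Star.star (eval κ t)

variable {E F : Type*} [NonUnitalCStarAlgebra E] [NonUnitalCStarAlgebra F]

theorem map_eval (φ : E →⋆ₙₐ[ℂ] F) (κ : A → E) (t : StarTerm A) :
    φ (t.eval κ) = t.eval fun a => φ (κ a) := by
  induction t with
  | zero => simp [eval]
  | of a => simp [eval]
  | add s t hs ht => simp [eval, hs, ht]
  | mul s t hs ht => simp [eval, hs, ht]
  | smul c t ht => simp [eval, ht]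
  | star t ht => simp [eval, ht, map_star]

/-- A bound for the norm of the value of a `*`-polynomial in terms of bounds for the norms of the
values of the variables. -/
def bound (c : A → ℝ) : StarTerm A → ℝ
  | zero => 0
  | of a => c a
  | add s t => bound c s + bound c t
  | mul s t => bound c s * bound c t
  | smul z t => ‖z‖ * bound c t
  | star t => bound c t

theorem norm_eval_le_bound {κ : A → E} {c : A → ℝ} (h : ∀ a, ‖κ a‖ ≤ c a) (t : StarTerm A) :
    ‖t.eval κ‖ ≤ t.bound c := by
  induction t with
  | zero => simp [eval, bound]
  | of a => exact h a
  | add s t hs ht => exact (norm_add_le _ _).trans (add_le_add hs ht)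
  | mul s t hs ht =>
    exact (norm_mul_le _ _).trans
      (mul_le_mul hs ht (norm_nonneg _) ((norm_nonneg _).trans hs))
  | smul z t ht =>
    simp only [eval, bound, norm_smul]
    gcongr
  | star t ht => simpa [eval, bound] using ht

theorem exists_eval_of_mem_adjoin (κ : A → E) {x : E}
    (hx : x ∈ NonUnitalStarAlgebra.adjoin ℂ (Set.range κ)) : ∃ t : StarTerm A, t.eval κ = x := by
  induction hx using NonUnitalStarAlgebra.adjoin_induction with
  | mem x hx => obtain ⟨a, rfl⟩ := hx; exact ⟨of a, rfl⟩
  | add x y _ _ hx hy =>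
    obtain ⟨s, rfl⟩ := hx; obtain ⟨t, rfl⟩ := hy; exact ⟨add s t, rfl⟩
  | zero => exact ⟨zero, rfl⟩
  | mul x y _ _ hx hy =>
    obtain ⟨s, rfl⟩ := hx; obtain ⟨t, rfl⟩ := hy; exact ⟨mul s t, rfl⟩
  | smul c x _ hx => obtain ⟨s, rfl⟩ := hx; exact ⟨smul c s, rfl⟩
  | star x _ hx => obtain ⟨s, rfl⟩ := hx; exact ⟨star s, rfl⟩

end StarTerm

/-- The `C*`-algebra generated by the values of `κ`. -/
def genAlg {A : Type u} {E : Type*} [NonUnitalCStarAlgebra E] (κ : A → E) :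
    NonUnitalStarSubalgebra ℂ E :=
  (NonUnitalStarAlgebra.adjoin ℂ (Set.range κ)).topologicalClosure

section GenAlg

variable {A : Type u} {E F : Type*} [NonUnitalCStarAlgebra E] [NonUnitalCStarAlgebra F]

instance (κ : A → E) : NonUnitalCStarAlgebra (genAlg κ) :=
  NonUnitalStarSubalgebra.nonUnitalCStarAlgebra (genAlg κ)
    (h_closed := NonUnitalStarSubalgebra.isClosed_topologicalClosure _)

/-- The generators, as elements of the generated `C*`-algebra. -/
def gen (κ : A → E) (a : A) : genAlg κ :=
  ⟨κ a, NonUnitalStarSubalgebra.le_topologicalClosure _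
    (NonUnitalStarAlgebra.subset_adjoin ℂ _ (Set.mem_range_self a))⟩

theorem coe_eval_gen (κ : A → E) (t : StarTerm A) :
    ((t.eval (gen κ) : genAlg κ) : E) = t.eval κ :=
  StarTerm.map_eval (NonUnitalStarSubalgebraClass.subtype (genAlg κ)) (gen κ) t

theorem norm_eval_gen (κ : A → E) (t : StarTerm A) : ‖t.eval (gen κ)‖ = ‖t.eval κ‖ := by
  exact congrArg norm (coe_eval_gen κ t)

/-- The values of the `*`-polynomials in the generators are dense. -/
theorem denseRange_eval_gen (κ : A → E) :
    DenseRange fun t : StarTerm A => t.eval (gen κ) := by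
  intro x
  have hx : (x : E) ∈ closure (NonUnitalStarAlgebra.adjoin ℂ (Set.range κ) : Set E) := x.2
  rw [Metric.mem_closure_iff] at hx ⊢
  intro ε hε
  obtain ⟨y, hy, hxy⟩ := hx ε hε
  obtain ⟨t, rfl⟩ := StarTerm.exists_eval_of_mem_adjoin κ hy
  refine ⟨_, ⟨t, rfl⟩, ?_⟩
  rw [Subtype.dist_eq]
  simpa only [coe_eval_gen] using hxy

theorem genAlg_hom_ext {κ : A → E} {φ ψ : genAlg κ →⋆ₙₐ[ℂ] F}
    (h : ∀ a, φ (gen κ a) = ψ (gen κ a)) : φ = ψ := by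
  apply DFunLike.coe_injective
  refine (denseRange_eval_gen κ).equalizer (continuous_starHom φ) (continuous_starHom ψ) ?_
  funext t
  simp only [Function.comp_apply, StarTerm.map_eval, h]

theorem genAlg_hom_surjective {κ : A → E} {φ : F →⋆ₙₐ[ℂ] genAlg κ} {ρ : A → F}
    (h : ∀ a, φ (ρ a) = gen κ a) : Function.Surjective φ := by
  rw [← Set.range_eq_univ, ← (isClosed_range_starHom φ).closure_eq]
  refine ((denseRange_eval_gen κ).mono ?_).closure_eq
  rintro _ ⟨t, rfl⟩
  exact ⟨t.eval ρ, by simp only [StarTerm.map_eval, h]⟩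

/-- A map from a generated `C*`-algebra that takes generators into a generated `C*`-algebra
takes values there. -/
theorem apply_mem_genAlg {κ : A → E} {ρ : A → F} (φ : genAlg κ →⋆ₙₐ[ℂ] F)
    (h : ∀ a, φ (gen κ a) = ρ a) (x : genAlg κ) : φ x ∈ genAlg ρ := by
  have hcl : IsClosed {x | φ x ∈ genAlg ρ} :=
    (NonUnitalStarSubalgebra.isClosed_topologicalClosure _ :
      IsClosed (genAlg ρ : Set F)).preimage (continuous_starHom φ)
  refine (denseRange_eval_gen κ).induction_on x hcl fun t => ?_
  simp only [StarTerm.map_eval, h]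
  rw [← coe_eval_gen]
  exact Subtype.mem _

/-- If all `*`-polynomials have smaller norm on `ρ` than on `κ`, then `κ a ↦ ρ a` extends to a
`*`-homomorphism of the generated `C*`-algebra. -/
theorem exists_genAlg_hom {κ : A → E} {ρ : A → F}
    (h : ∀ t : StarTerm A, ‖t.eval ρ‖ ≤ ‖t.eval κ‖) :
    ∃ θ : genAlg κ →⋆ₙₐ[ℂ] F, ∀ a, θ (gen κ a) = ρ a := by
  -- Graph argument: in the algebra generated by the pairs `(κ a, ρ a)` the second coordinate is
  -- dominated by the first. The first projection is therefore an isomorphism onto `genAlg κ`, and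
  -- its inverse followed by the second projection is `θ`.
  let τ : A → E × F := fun a => (κ a, ρ a)
  let p : genAlg τ →⋆ₙₐ[ℂ] E :=
    (NonUnitalStarAlgHom.fst ℂ E F).comp (NonUnitalStarSubalgebraClass.subtype (genAlg τ))
  let r : genAlg τ →⋆ₙₐ[ℂ] F :=
    (NonUnitalStarAlgHom.snd ℂ E F).comp (NonUnitalStarSubalgebraClass.subtype (genAlg τ))
  have hp : ∀ a, p (gen τ a) = κ a := fun _ => rfl
  have hr : ∀ a, r (gen τ a) = ρ a := fun _ => rfl
  have hle : ∀ x, ‖r x‖ ≤ ‖p x‖ := by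
    intro x
    refine (denseRange_eval_gen τ).induction_on x ?_ fun t => ?_
    · exact isClosed_le (continuous_starHom r).norm (continuous_starHom p).norm
    · simp only [StarTerm.map_eval, hp, hr, h t]
  let p' : genAlg τ →⋆ₙₐ[ℂ] genAlg κ := NonUnitalStarAlgHom.codRestrict p _ (apply_mem_genAlg p hp)
  have hp' : ∀ a, p' (gen τ a) = gen κ a := fun a => Subtype.ext (hp a)
  have hinj : Function.Injective p' := by
    rw [injective_iff_map_eq_zero]
    intro x hx
    have h1 : p x = 0 := congrArg Subtype.val hx
    have h2 : r x = 0 := by simpa [h1] using hle x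
    exact Subtype.ext (Prod.ext h1 h2)
  let e : genAlg τ ≃⋆ₐ[ℂ] genAlg κ :=
    StarAlgEquiv.ofBijective p' ⟨hinj, genAlg_hom_surjective hp'⟩
  refine ⟨r.comp (e.symm : genAlg κ →⋆ₙₐ[ℂ] genAlg τ), fun a => ?_⟩
  have : e.symm (gen κ a) = gen τ a := by
    rw [StarAlgEquiv.symm_apply_eq]; exact (hp' a).symm
  change r (e.symm (gen κ a)) = ρ a
  rw [this, hr]

/-- If every `*`-polynomial has smaller norm on `ρ` than on `κ`, then there is a surjection of the
generated `C*`-algebras. -/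
theorem exists_genAlg_surjection {κ : A → E} {ρ : A → F}
    (h : ∀ t : StarTerm A, ‖t.eval ρ‖ ≤ ‖t.eval κ‖) :
    ∃ θ : genAlg κ →⋆ₙₐ[ℂ] genAlg ρ, Function.Surjective θ ∧ ∀ a, θ (gen κ a) = gen ρ a := by
  obtain ⟨θ, hθ⟩ := exists_genAlg_hom h
  have h' : ∀ a, NonUnitalStarAlgHom.codRestrict θ (genAlg ρ) (apply_mem_genAlg θ hθ) (gen κ a) =
      gen ρ a := fun a => Subtype.ext (hθ a)
  exact ⟨_, genAlg_hom_surjective h', h'⟩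

theorem norm_eval_le_of_hom {κ : A → E} {ρ : A → F} (θ : genAlg κ →⋆ₙₐ[ℂ] F)
    (h : ∀ a, θ (gen κ a) = ρ a) (t : StarTerm A) : ‖t.eval ρ‖ ≤ ‖t.eval κ‖ := by
  have := NonUnitalStarAlgHom.norm_apply_le θ (t.eval (gen κ))
  simpa only [StarTerm.map_eval, h, norm_eval_gen] using this

end GenAlg

end

end OpAlg

namespace OpAlg

noncomputable section

open scoped ENNReal

/-! ### Separating families of `*`-homomorphisms -/

section Separating

variable {I : Type*} {E : I → Type*} [∀ i, NonUnitalCStarAlgebra (E i)]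
  {B : Type*} [NonUnitalCStarAlgebra B]

/-- Evaluation of bounded families. -/
def lpEval (i : I) : lp E ∞ →⋆ₙₐ[ℂ] E i where
  toFun f := f i
  map_smul' _ _ := rfl
  map_zero' := rfl
  map_add' _ _ := rfl
  map_mul' _ _ := rfl
  map_star' _ := rfl

/-- A family of `*`-homomorphisms, as a `*`-homomorphism into the algebra of bounded families. -/
def lpHom (φ : ∀ i, B →⋆ₙₐ[ℂ] E i) : B →⋆ₙₐ[ℂ] lp E ∞ where
  toFun b := ⟨fun i => φ i b, memℓp_infty ⟨‖b‖, by
    rintro _ ⟨i, rfl⟩; exact NonUnitalStarAlgHom.norm_apply_le (φ i) b⟩⟩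
  map_smul' c b := lp.ext (funext fun i => map_smul (φ i) c b)
  map_zero' := lp.ext (funext fun i => map_zero (φ i))
  map_add' a b := lp.ext (funext fun i => map_add (φ i) a b)
  map_mul' a b := lp.ext (funext fun i => map_mul (φ i) a b)
  map_star' b := lp.ext (funext fun i => map_star (φ i) b)

/-- A separating family of `*`-homomorphisms computes the norm. -/
theorem norm_le_of_separating (φ : ∀ i, B →⋆ₙₐ[ℂ] E i)
    (hsep : ∀ b, (∀ i, φ i b = 0) → b = 0) {b : B} {c : ℝ} (hc : 0 ≤ c)
    (h : ∀ i, ‖φ i b‖ ≤ c) : ‖b‖ ≤ c := by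
  have hinj : Function.Injective (lpHom φ) := by
    rw [injective_iff_map_eq_zero]
    intro x hx
    exact hsep x fun i => congrArg (fun f : lp E ∞ => f i) hx
  rw [← NonUnitalStarAlgHom.norm_map (lpHom φ) hinj b]
  exact lp.norm_le_of_forall_le hc h

end Separating

/-! ### Operator matrices -/

section OpMatrix

variable {K : Type*} [NormedAddCommGroup K] [InnerProductSpace ℂ K] {n : ℕ}

theorem opMatrix_apply (T : Matrix (Fin n) (Fin n) (K →L[ℂ] K)) (x : PiLp 2 fun _ : Fin n => K)
    (i : Fin n) : opMatrix T x i = ∑ j, T i j (x j) := by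
  simp [opMatrix]

theorem norm_le_norm_opMatrix (T : Matrix (Fin 1) (Fin 1) (K →L[ℂ] K)) :
    ‖T 0 0‖ ≤ ‖opMatrix T‖ := by
  refine (T 0 0).opNorm_le_bound (ContinuousLinearMap.opNorm_nonneg _) fun x => ?_
  have := (opMatrix T).le_opNorm (WithLp.toLp 2 fun _ => x)
  simpa [PiLp.norm_eq_of_L2, opMatrix_apply] using this

/-- The passage from matrices of operators to operators, as a `*`-homomorphism. -/
def opMatrixHom (K : Type*) [NormedAddCommGroup K] [InnerProductSpace ℂ K] [CompleteSpace K]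
    (n : ℕ) : CStarMatrix (Fin n) (Fin n) (K →L[ℂ] K) →⋆ₙₐ[ℂ]
      (PiLp 2 (fun _ : Fin n => K) →L[ℂ] PiLp 2 (fun _ : Fin n => K)) where
  toFun M := opMatrix (CStarMatrix.ofMatrix.symm M)
  map_smul' c M := by
    ext x i
    simp [opMatrix_apply, Finset.smul_sum]
  map_zero' := by
    ext x i
    simp [opMatrix_apply]
  map_add' M N := by
    ext x i
    simp [opMatrix_apply, Finset.sum_add_distrib]
  map_mul' M N := by
    ext x i
    simp only [opMatrix_apply, mul_apply_eq_comp, CStarMatrix.ofMatrix_symm_apply,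
      CStarMatrix.mul_apply, _root_.sum_apply, map_sum]
    exact Finset.sum_comm
  map_star' M := by
    rw [ContinuousLinearMap.star_eq_adjoint, ContinuousLinearMap.eq_adjoint_iff]
    intro x y
    simp only [PiLp.inner_apply, opMatrix_apply, sum_inner, inner_sum,
      CStarMatrix.ofMatrix_symm_apply, CStarMatrix.star_apply, ContinuousLinearMap.star_eq_adjoint,
      ContinuousLinearMap.adjoint_inner_left]
    exact Finset.sum_comm

theorem opMatrixHom_injective (K : Type*) [NormedAddCommGroup K] [InnerProductSpace ℂ K]
    [CompleteSpace K] (n : ℕ) : Function.Injective (opMatrixHom K n) := by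
  rw [injective_iff_map_eq_zero]
  intro M hM
  ext i j x
  have := congrArg (fun T => T (PiLp.single 2 j x) i) hM
  simpa [opMatrixHom, opMatrix_apply, PiLp.single_apply, apply_ite] using this

/-- The amplification of a `*`-representation. -/
def amplify {B : Type*} [NonUnitalCStarAlgebra B] [CompleteSpace K] (φ : B →⋆ₙₐ[ℂ] (K →L[ℂ] K))
    (n : ℕ) : CStarMatrix (Fin n) (Fin n) B →⋆ₙₐ[ℂ]
      (PiLp 2 (fun _ : Fin n => K) →L[ℂ] PiLp 2 (fun _ : Fin n => K)) :=
  (opMatrixHom K n).comp (CStarMatrix.mapₙₐ φ)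

theorem amplify_ofMatrix {B : Type*} [NonUnitalCStarAlgebra B] [CompleteSpace K]
    (φ : B →⋆ₙₐ[ℂ] (K →L[ℂ] K)) (M : Matrix (Fin n) (Fin n) B) :
    amplify φ n (CStarMatrix.ofMatrix M) = opMatrix (M.map φ) := rfl

/-- A separating family of `*`-representations computes the norms of matrices. -/
theorem norm_opMatrix_le_of_separating {B : Type*} [NonUnitalCStarAlgebra B] [CompleteSpace K]
    (ψ : B →⋆ₙₐ[ℂ] (K →L[ℂ] K)) {I : Type*} {L : I → Type*} [∀ i, NormedAddCommGroup (L i)]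
    [∀ i, InnerProductSpace ℂ (L i)] [∀ i, CompleteSpace (L i)]
    (φ : ∀ i, B →⋆ₙₐ[ℂ] (L i →L[ℂ] L i)) (hsep : ∀ b, (∀ i, φ i b = 0) → b = 0)
    (M : Matrix (Fin n) (Fin n) B) {c : ℝ} (hc : 0 ≤ c)
    (h : ∀ i, ‖opMatrix (M.map (φ i))‖ ≤ c) : ‖opMatrix (M.map ψ)‖ ≤ c := by
  -- The order serves only to make the matrices over `B` a C*-algebra.
  let _ := CStarAlgebra.spectralOrder B
  have := CStarAlgebra.spectralOrderedRing B
  rw [← amplify_ofMatrix]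
  refine (NonUnitalStarAlgHom.norm_apply_le _ _).trans
    (norm_le_of_separating (fun i => amplify (φ i) n) (fun N hN => ?_) hc h)
  ext i j
  refine hsep _ fun k => ?_
  have := (injective_iff_map_eq_zero _).1 (opMatrixHom_injective (L k) n) _ (hN k)
  exact congrArg (fun N : CStarMatrix (Fin n) (Fin n) _ => N i j) this

/-- `*`-representations are completely contractive. -/
theorem norm_opMatrix_map_le {B : Type*} [NonUnitalCStarAlgebra B] [CompleteSpace K]
    (ψ : B →⋆ₙₐ[ℂ] (K →L[ℂ] K)) {L : Type*} [NormedAddCommGroup L]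
    [InnerProductSpace ℂ L] [CompleteSpace L] (φ : B →⋆ₙₐ[ℂ] (L →L[ℂ] L))
    (hφ : Function.Injective φ) (M : Matrix (Fin n) (Fin n) B) :
    ‖opMatrix (M.map ψ)‖ ≤ ‖opMatrix (M.map φ)‖ :=
  norm_opMatrix_le_of_separating ψ (fun _ : Unit => φ)
    (fun b hb => (injective_iff_map_eq_zero _).1 hφ b (hb ())) M (norm_nonneg _) fun _ => le_rfl

end OpMatrix

/-! ### Direct sums -/

section DirectSum

variable {I : Type*} {K : I → Type*} [∀ i, NormedAddCommGroup (K i)]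
  [∀ i, InnerProductSpace ℂ (K i)]

/-- The diagonal operator on the Hilbert space sum given by a bounded family of operators. -/
def diagOp (T : lp (fun i => K i →L[ℂ] K i) ∞) : lp K 2 →L[ℂ] lp K 2 :=
  LinearMap.mkContinuous
    { toFun := fun x => ⟨fun i => T i (x i), by
        refine ((lp.memℓp x).norm.const_mul ‖T‖).mono fun i => ?_
        refine ((T i).le_opNorm _).trans ?_
        exact mul_le_mul_of_nonneg_right (lp.norm_apply_le_norm ENNReal.top_ne_zero T i)
          (norm_nonneg _)⟩
      map_add' := fun x y => lp.ext (funext fun i => map_add (T i) (x i) (y i))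
      map_smul' := fun c x => lp.ext (funext fun i => map_smul (T i) c (x i)) } ‖T‖ (by
    intro x
    have h2 : 0 < (2 : ℝ≥0∞).toReal := by norm_num
    refine lp.norm_le_of_forall_sum_le h2 (by positivity) fun s => ?_
    rw [Real.mul_rpow (norm_nonneg _) (norm_nonneg _)]
    refine le_trans ?_ (mul_le_mul_of_nonneg_left (lp.sum_rpow_le_norm_rpow h2 x s)
      (by positivity))
    rw [Finset.mul_sum]
    refine Finset.sum_le_sum fun i _ => ?_
    rw [← Real.mul_rpow (norm_nonneg _) (norm_nonneg _)]
    refine Real.rpow_le_rpow (norm_nonneg _) (((T i).le_opNorm _).trans ?_) h2.le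
    exact mul_le_mul_of_nonneg_right (lp.norm_apply_le_norm ENNReal.top_ne_zero T i)
      (norm_nonneg _))

theorem diagOp_apply (T : lp (fun i => K i →L[ℂ] K i) ∞) (x : lp K 2) (i : I) :
    diagOp T x i = T i (x i) := rfl

variable [∀ i, CompleteSpace (K i)]

/-- Diagonal operators, as a `*`-representation. -/
def diagHom (K : I → Type*) [∀ i, NormedAddCommGroup (K i)]
    [∀ i, InnerProductSpace ℂ (K i)] [∀ i, CompleteSpace (K i)] :
    lp (fun i => K i →L[ℂ] K i) ∞ →⋆ₙₐ[ℂ] (lp K 2 →L[ℂ] lp K 2) where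
  toFun := diagOp
  map_smul' _ _ := rfl
  map_zero' := rfl
  map_add' _ _ := rfl
  map_mul' _ _ := rfl
  map_star' T := by
    rw [ContinuousLinearMap.star_eq_adjoint, ContinuousLinearMap.eq_adjoint_iff]
    intro x y
    rw [lp.inner_eq_tsum, lp.inner_eq_tsum]
    refine tsum_congr fun i => ?_
    rw [diagOp_apply, diagOp_apply, lp.star_apply, ContinuousLinearMap.star_eq_adjoint,
      ContinuousLinearMap.adjoint_inner_left]

theorem diagHom_injective : Function.Injective (diagHom K) := by
  classical
  rw [injective_iff_map_eq_zero]
  intro T hT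
  refine lp.ext (funext fun i => ContinuousLinearMap.ext fun x => ?_)
  have := congrArg (fun S : lp K 2 →L[ℂ] lp K 2 => S (lp.single 2 i x) i) hT
  change T i (lp.single (E := K) 2 i x i) = 0 at this
  rwa [lp.single_apply_self] at this

end DirectSum

end

end OpAlg

namespace OpAlg

noncomputable section

open scoped ENNReal

theorem le_of_forall_le_add_one_div {x y : ℝ} (h : ∀ n : ℕ, x ≤ y + 1 / (n + 1)) : x ≤ y := by
  refine le_of_forall_pos_le_add fun ε hε => ?_
  obtain ⟨n, hn⟩ := exists_nat_one_div_lt hε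
  exact (h n).trans (by gcongr)

/-- A family of `*`-homomorphisms that computes the norm on a dense set is separating. -/
theorem separating_of_denseRange {B T I : Type*} [NonUnitalCStarAlgebra B] {E : I → Type*}
    [∀ i, NonUnitalCStarAlgebra (E i)] (π : ∀ i, B →⋆ₙₐ[ℂ] E i) {d : T → B} (hd : DenseRange d)
    (h : ∀ t c, 0 ≤ c → (∀ i, ‖π i (d t)‖ ≤ c) → ‖d t‖ ≤ c) (b : B) (hb : ∀ i, π i b = 0) :
    b = 0 := by
  rw [← norm_le_zero_iff]
  refine le_of_forall_pos_le_add fun ε hε => ?_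
  obtain ⟨_, ⟨t, rfl⟩, ht⟩ := Metric.mem_closure_iff.1 (hd b) (ε / 2) (half_pos hε)
  rw [dist_eq_norm] at ht
  have h1 : ‖d t‖ ≤ ε / 2 := by
    refine h t _ (half_pos hε).le fun i => ?_
    have h2 : π i (d t) = -π i (b - d t) := by rw [map_sub, hb i, zero_sub, neg_neg]
    rw [h2, norm_neg]
    exact (NonUnitalStarAlgHom.norm_apply_le _ _).trans ht.le
  calc ‖b‖ = ‖(b - d t) + d t‖ := by rw [sub_add_cancel]
    _ ≤ ‖b - d t‖ + ‖d t‖ := norm_add_le _ _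
    _ ≤ 0 + ε := by linarith

/-! ### Representations of `A` and their direct sums -/

section Reps

variable {H : Type u} [NormedAddCommGroup H] [InnerProductSpace ℂ H]
  {A : NonUnitalSubalgebra ℂ (H →L[ℂ] H)}

theorem IsCompletelyContractive.norm_apply_le {K : Type*} [NormedAddCommGroup K]
    [InnerProductSpace ℂ K] {ρ : A →ₙₐ[ℂ] (K →L[ℂ] K)} (hρ : IsCompletelyContractive ρ) (a : A) :
    ‖ρ a‖ ≤ matrixNorm A (Matrix.of fun _ _ : Fin 1 => a) :=
  (norm_le_norm_opMatrix ((Matrix.of fun _ _ : Fin 1 => a).map ρ)).trans (hρ 1 _)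

theorem IsCompletelyIsometric.isCompletelyContractive {K : Type*} [NormedAddCommGroup K]
    [InnerProductSpace ℂ K] {ρ : A →ₙₐ[ℂ] (K →L[ℂ] K)} (hρ : IsCompletelyIsometric ρ) :
    IsCompletelyContractive ρ := fun n M => (hρ n M).le

theorem matrixNorm_nonneg {n : ℕ} (M : Matrix (Fin n) (Fin n) A) : 0 ≤ matrixNorm A M :=
  ContinuousLinearMap.opNorm_nonneg _

section Sum

variable {I : Type*} {K : I → Type*} [∀ i, NormedAddCommGroup (K i)]
  [∀ i, InnerProductSpace ℂ (K i)] [∀ i, CompleteSpace (K i)]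
  (ρ : ∀ i, A →ₙₐ[ℂ] (K i →L[ℂ] K i)) (hρ : ∀ i, IsCompletelyContractive (ρ i))

/-- A family of representations, as a homomorphism into the bounded families of operators. -/
def famRep : A →ₙₐ[ℂ] lp (fun i => K i →L[ℂ] K i) ∞ where
  toFun a := ⟨fun i => ρ i a, memℓp_infty ⟨_, by
    rintro _ ⟨i, rfl⟩; exact (hρ i).norm_apply_le a⟩⟩
  map_smul' c b := lp.ext (funext fun i => map_smul (ρ i) c b)
  map_zero' := lp.ext (funext fun i => map_zero (ρ i))
  map_add' a b := lp.ext (funext fun i => map_add (ρ i) a b)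
  map_mul' a b := lp.ext (funext fun i => map_mul (ρ i) a b)

/-- The direct sum of a family of representations. -/
def sumRep : A →ₙₐ[ℂ] (lp K 2 →L[ℂ] lp K 2) :=
  (diagHom K : lp (fun i => K i →L[ℂ] K i) ∞ →ₙₐ[ℂ] (lp K 2 →L[ℂ] lp K 2)).comp (famRep ρ hρ)

/-- The coordinate evaluations separate bounded families, so they compute the norm of a matrix of
diagonal operators. -/
theorem sumRep_isCompletelyContractive : IsCompletelyContractive (sumRep ρ hρ) := fun n M =>
  norm_opMatrix_le_of_separating (diagHom K)
    (fun i => lpEval (E := fun i => K i →L[ℂ] K i) i) (fun _ hb => lp.ext (funext hb))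
    (M.map (famRep ρ hρ)) (matrixNorm_nonneg M) fun i => hρ i n M

theorem norm_opMatrix_map_le_sumRep (i : I) {n : ℕ} (M : Matrix (Fin n) (Fin n) A) :
    ‖opMatrix (M.map (ρ i))‖ ≤ ‖opMatrix (M.map (sumRep ρ hρ))‖ :=
  norm_opMatrix_map_le (lpEval (E := fun i => K i →L[ℂ] K i) i) (diagHom K) diagHom_injective
    (M.map (famRep ρ hρ))

theorem norm_eval_sumRep (t : StarTerm A) :
    ‖t.eval (sumRep ρ hρ)‖ = ‖t.eval (famRep ρ hρ)‖ := by
  rw [← NonUnitalStarAlgHom.norm_map (diagHom K) diagHom_injective, StarTerm.map_eval]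
  rfl

theorem eval_famRep_apply (t : StarTerm A) (i : I) :
    t.eval (famRep ρ hρ) i = t.eval (ρ i) :=
  StarTerm.map_eval (lpEval (E := fun i => K i →L[ℂ] K i) i) (famRep ρ hρ) t

theorem norm_eval_le_sumRep (t : StarTerm A) (i : I) :
    ‖t.eval (ρ i)‖ ≤ ‖t.eval (sumRep ρ hρ)‖ := by
  rw [norm_eval_sumRep, ← eval_famRep_apply ρ hρ]
  exact lp.norm_apply_le_norm ENNReal.top_ne_zero _ i

theorem norm_eval_sumRep_le (t : StarTerm A) {c : ℝ} (hc : 0 ≤ c)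
    (h : ∀ i, ‖t.eval (ρ i)‖ ≤ c) : ‖t.eval (sumRep ρ hρ)‖ ≤ c := by
  rw [norm_eval_sumRep]
  refine lp.norm_le_of_forall_le hc fun i => ?_
  rw [eval_famRep_apply]
  exact h i

/-- Quantifying over bounds `c ≥ 0` replaces a supremum over `i`, so neither boundedness nor
nonemptiness of the family has to be discussed. -/
theorem sumRep_isCompletelyIsometric
    (h : ∀ (n : ℕ) (M : Matrix (Fin n) (Fin n) A) (c : ℝ), 0 ≤ c →
      (∀ i, ‖opMatrix (M.map (ρ i))‖ ≤ c) → matrixNorm A M ≤ c) :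
    IsCompletelyIsometric (sumRep ρ hρ) := fun n M =>
  le_antisymm (sumRep_isCompletelyContractive _ _ n M)
    (h n M _ (ContinuousLinearMap.opNorm_nonneg _) fun i => norm_opMatrix_map_le_sumRep ρ hρ i M)

end Sum

/-! ### Covers compared through the norms of `*`-polynomials -/

namespace CStarCover

theorem norm_eval_emb (C : CStarCover A) (t : StarTerm A) : ‖t.eval C.emb‖ = ‖t.eval C.ι‖ :=
  norm_eval_gen C.ι t

theorem hom_ext {C : CStarCover A} {F : Type*} [NonUnitalCStarAlgebra F]
    {φ ψ : C.alg →⋆ₙₐ[ℂ] F} (h : ∀ a, φ (C.emb a) = ψ (C.emb a)) : φ = ψ :=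
  genAlg_hom_ext (κ := C.ι) h

theorem exists_hom (C : CStarCover A) {F : Type*} [NonUnitalCStarAlgebra F] {ρ : A → F}
    (h : ∀ t : StarTerm A, ‖t.eval ρ‖ ≤ ‖t.eval C.ι‖) :
    ∃ θ : C.alg →⋆ₙₐ[ℂ] F, ∀ a, θ (C.emb a) = ρ a :=
  exists_genAlg_hom h

theorem norm_eval_le (C : CStarCover A) {F : Type*} [NonUnitalCStarAlgebra F] {ρ : A → F}
    {θ : C.alg →⋆ₙₐ[ℂ] F} (h : ∀ a, θ (C.emb a) = ρ a) (t : StarTerm A) :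
    ‖t.eval ρ‖ ≤ ‖t.eval C.ι‖ :=
  norm_eval_le_of_hom (κ := C.ι) θ h t

/-- Norm domination extends the map of generators to a `*`-homomorphism; surjectivity is then
automatic, since the range is closed and contains the generators. -/
theorem below_iff {C D : CStarCover A} :
    C.Below D ↔ ∀ t : StarTerm A, ‖t.eval C.ι‖ ≤ ‖t.eval D.ι‖ := by
  refine ⟨?_, fun h => exists_genAlg_surjection h⟩
  rintro ⟨π, -, hπ⟩ t
  rw [← norm_eval_emb]
  exact D.norm_eval_le hπ t

theorem dense_eval (C : CStarCover A) : DenseRange fun t : StarTerm A => t.eval C.emb :=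
  denseRange_eval_gen C.ι

/-- The embedding of `A` into the algebra of a cover, as a homomorphism. -/
def embHom (C : CStarCover A) : A →ₙₐ[ℂ] C.alg where
  toFun := C.emb
  map_smul' c a := Subtype.ext (map_smul C.ι c a)
  map_zero' := Subtype.ext (map_zero C.ι)
  map_add' a b := Subtype.ext (map_add C.ι a b)
  map_mul' a b := Subtype.ext (map_mul C.ι a b)

variable {K : Type*} [NormedAddCommGroup K] [InnerProductSpace ℂ K] [CompleteSpace K]

/-- The restriction to `A` of a `*`-representation of the algebra of a cover. -/
def restrict (C : CStarCover A) (φ : C.alg →⋆ₙₐ[ℂ] (K →L[ℂ] K)) : A →ₙₐ[ℂ] (K →L[ℂ] K) :=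
  (φ : C.alg →ₙₐ[ℂ] (K →L[ℂ] K)).comp C.embHom

/-- As `C.ι` is completely isometric, matrix norms over `A` are those of the faithful inclusion of
`C.alg`, which dominate those of any `*`-representation. -/
theorem restrict_isCompletelyContractive (C : CStarCover A) (φ : C.alg →⋆ₙₐ[ℂ] (K →L[ℂ] K)) :
    IsCompletelyContractive (C.restrict φ) := by
  intro n M
  rw [← C.isometric n M]
  exact norm_opMatrix_map_le φ (NonUnitalStarSubalgebraClass.subtype C.alg)
    Subtype.val_injective (M.map C.embHom)

theorem isMax_of_norm_eval_le {M : CStarCover A}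
    (h : ∀ (K : Type u) [NormedAddCommGroup K] [InnerProductSpace ℂ K] [CompleteSpace K]
      (ρ : A →ₙₐ[ℂ] (K →L[ℂ] K)), IsCompletelyContractive ρ →
      ∀ t : StarTerm A, ‖t.eval ρ‖ ≤ ‖t.eval M.ι‖) : M.IsMax := by
  intro K _ _ _ ρ hρ
  obtain ⟨θ, hθ⟩ := M.exists_hom (h K ρ hρ)
  exact ⟨θ, hθ, fun θ' hθ' => hom_ext fun a => (hθ' a).trans (hθ a).symm⟩

end CStarCover

/-! ### The maximal cover -/

/-- A representation of `A`, together with its Hilbert space. -/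
structure Rep (A : NonUnitalSubalgebra ℂ (H →L[ℂ] H)) where
  /-- the Hilbert space -/
  K : Type u
  [normed : NormedAddCommGroup K]
  [inner : InnerProductSpace ℂ K]
  [complete : CompleteSpace K]
  /-- the representation -/
  ρ : A →ₙₐ[ℂ] (K →L[ℂ] K)
  contractive : IsCompletelyContractive ρ

attribute [instance] Rep.normed Rep.inner Rep.complete

theorem isCompletelyIsometric_subtype (A : NonUnitalSubalgebra ℂ (H →L[ℂ] H)) :
    IsCompletelyIsometric (NonUnitalSubalgebraClass.subtype A) := fun _ _ => rfl

/-- The identity representation. -/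
def Rep.id [CompleteSpace H] (A : NonUnitalSubalgebra ℂ (H →L[ℂ] H)) : Rep A :=
  ⟨H, NonUnitalSubalgebraClass.subtype A, (isCompletelyIsometric_subtype A).isCompletelyContractive⟩

/-- A single representation nearly attains the universal norm of a `*`-polynomial. -/
theorem exists_rep_norm_eval [CompleteSpace H] (t : StarTerm A) (n : ℕ) :
    ∃ r : Rep A, ∀ s : Rep A, ‖t.eval s.ρ‖ ≤ ‖t.eval r.ρ‖ + 1 / (n + 1) := by
  let S : Set ℝ := Set.range fun r : Rep A => ‖t.eval r.ρ‖
  have hne : S.Nonempty := ⟨_, Rep.id A, rfl⟩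
  -- Contractivity bounds each generator independently of the representation, hence also each
  -- `*`-polynomial.
  have hbd : BddAbove S := by
    refine ⟨t.bound fun a => matrixNorm A (Matrix.of fun _ _ : Fin 1 => a), ?_⟩
    rintro _ ⟨r, rfl⟩
    exact StarTerm.norm_eval_le_bound r.contractive.norm_apply_le t
  obtain ⟨_, ⟨r, rfl⟩, hr⟩ := exists_lt_of_lt_csSup hne
    (sub_lt_self (sSup S) (Nat.one_div_pos_of_nat (α := ℝ) (n := n)))
  refine ⟨r, fun s => ?_⟩
  have := le_csSup hbd ⟨s, rfl⟩
  simp only at this hr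
  linarith

/-- The cover given by the direct sum of a completely norming family of representations. -/
def sumCover {I : Type u} {K : I → Type u} [∀ i, NormedAddCommGroup (K i)]
    [∀ i, InnerProductSpace ℂ (K i)] [∀ i, CompleteSpace (K i)]
    (ρ : ∀ i, A →ₙₐ[ℂ] (K i →L[ℂ] K i)) (hρ : ∀ i, IsCompletelyContractive (ρ i))
    (h : ∀ (n : ℕ) (M : Matrix (Fin n) (Fin n) A) (c : ℝ), 0 ≤ c →
      (∀ i, ‖opMatrix (M.map (ρ i))‖ ≤ c) → matrixNorm A M ≤ c) : CStarCover A where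
  K := lp K 2
  ι := sumRep ρ hρ
  isometric := sumRep_isCompletelyIsometric ρ hρ h

theorem norm_eval_le_sumCover {I : Type u} {K : I → Type u} [∀ i, NormedAddCommGroup (K i)]
    [∀ i, InnerProductSpace ℂ (K i)] [∀ i, CompleteSpace (K i)]
    (ρ : ∀ i, A →ₙₐ[ℂ] (K i →L[ℂ] K i)) (hρ : ∀ i, IsCompletelyContractive (ρ i))
    (h : ∀ (n : ℕ) (M : Matrix (Fin n) (Fin n) A) (c : ℝ), 0 ≤ c →
      (∀ i, ‖opMatrix (M.map (ρ i))‖ ≤ c) → matrixNorm A M ≤ c) (t : StarTerm A) (i : I) :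
    ‖t.eval (ρ i)‖ ≤ ‖t.eval (sumCover ρ hρ h).ι‖ :=
  norm_eval_le_sumRep ρ hρ t i

/-- The representations of `A` form a type too large to be summed over. It suffices to take, for
every `*`-polynomial and every `n`, one whose norm is within `1 / (n + 1)` of the supremum. -/
theorem exists_isMax [CompleteSpace H] (A : NonUnitalSubalgebra ℂ (H →L[ℂ] H)) :
    ∃ M : CStarCover A, M.IsMax := by
  choose r hr using exists_rep_norm_eval (A := A)
  -- The extra index `none` carries the identity representation, which makes the sum completely
  -- isometric.
  let f : Option (StarTerm A × ℕ) → Rep A := fun o => o.elim (Rep.id A) fun p => r p.1 p.2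
  refine ⟨sumCover (fun i => (f i).ρ) (fun i => (f i).contractive) fun n M c _ h => h none,
    CStarCover.isMax_of_norm_eval_le fun K _ _ _ ρ hρ t => le_of_forall_le_add_one_div fun n =>
      (hr t n ⟨K, ρ, hρ⟩).trans ?_⟩
  gcongr
  exact norm_eval_le_sumCover (fun i => (f i).ρ) (fun i => (f i).contractive) _ t (some (t, n))

/-! ### The RFD-maximal cover -/

/-- A cover whose `C*`-norm dominates that of all finite-dimensional representations. -/
def CStarCover.FinDimDominates (R : CStarCover A) : Prop :=
  ∀ r : ℕ, 0 < r → ∀ ρ : A →ₙₐ[ℂ] (EuclideanSpace ℂ (Fin r) →L[ℂ] EuclideanSpace ℂ (Fin r)),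
    IsCompletelyContractive ρ → ∀ t : StarTerm A, ‖t.eval ρ‖ ≤ ‖t.eval R.ι‖

/-- The completely contractive representations of `A` on the spaces `ℂ^r`, `r > 0`. -/
abbrev FinDimRep (A : NonUnitalSubalgebra ℂ (H →L[ℂ] H)) : Type u :=
  Σ r : {r : ℕ // 0 < r},
    {ρ : A →ₙₐ[ℂ] (EuclideanSpace ℂ (Fin r) →L[ℂ] EuclideanSpace ℂ (Fin r)) //
      IsCompletelyContractive ρ}

/-- The cover given by the direct sum of all finite-dimensional representations. -/
def finDimCover (hA : IsRFD A) : CStarCover A where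
  K := lp (fun i : FinDimRep A => EuclideanSpace ℂ (Fin i.1)) 2
  ι := sumRep (fun i : FinDimRep A => i.2.1) fun i => i.2.2
  isometric := sumRep_isCompletelyIsometric _ _ fun n M c hc h => by
    obtain ⟨Λ, r, ρ, hr, hρ, hM⟩ := hA
    rw [hM n M]
    -- An empty family has supremum 0 in `ℝ`; this is where `0 ≤ c` enters.
    exact Real.iSup_le (fun l => h ⟨⟨r l, hr l⟩, ρ l, hρ l⟩) hc

theorem norm_eval_le_finDimCover (hA : IsRFD A) (t : StarTerm A) (i : FinDimRep A) :
    ‖t.eval i.2.1‖ ≤ ‖t.eval (finDimCover hA).ι‖ :=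
  norm_eval_le_sumRep (fun i : FinDimRep A => i.2.1) (fun i => i.2.2) t i

theorem norm_eval_finDimCover_le (hA : IsRFD A) (t : StarTerm A) {c : ℝ} (hc : 0 ≤ c)
    (h : ∀ i : FinDimRep A, ‖t.eval i.2.1‖ ≤ c) : ‖t.eval (finDimCover hA).ι‖ ≤ c :=
  norm_eval_sumRep_le (fun i : FinDimRep A => i.2.1) (fun i => i.2.2) t hc h

theorem finDimCover_isRFDCStar (hA : IsRFD A) : IsRFDCStar (finDimCover hA).alg := by
  choose π hπ using fun i : FinDimRep A =>
    (finDimCover hA).exists_hom fun t => norm_eval_le_finDimCover hA t i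
  refine ⟨FinDimRep A, fun i => i.1, π, fun i => i.1.2, fun b hb =>
    separating_of_denseRange π (finDimCover hA).dense_eval (fun t c hc h => ?_) b hb⟩
  rw [CStarCover.norm_eval_emb]
  refine norm_eval_finDimCover_le hA t hc fun i => ?_
  have := h i
  rw [StarTerm.map_eval] at this
  simpa only [hπ] using this

theorem finDimCover_finDimDominates (hA : IsRFD A) : (finDimCover hA).FinDimDominates :=
  fun r hr ρ hρ t => norm_eval_le_finDimCover hA t ⟨⟨r, hr⟩, ρ, hρ⟩

namespace CStarCover

/-- The matrix representations of an RFD algebra compute its norm, and each restricts to a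
finite-dimensional representation of `A`, which `R` dominates. -/
theorem FinDimDominates.below {R C : CStarCover A} (hR : R.FinDimDominates)
    (hC : IsRFDCStar C.alg) : C.Below R := by
  obtain ⟨Λ, r, π, hr, hπ⟩ := hC
  rw [below_iff]
  intro t
  rw [← norm_eval_emb]
  refine norm_le_of_separating π hπ (norm_nonneg _) fun l => ?_
  rw [StarTerm.map_eval]
  exact hR (r l) (hr l) (C.restrict (π l)) (C.restrict_isCompletelyContractive (π l)) t

theorem exists_isRFDMax (hA : IsRFD A) : ∃ R : CStarCover A, R.IsRFDMax :=
  ⟨finDimCover hA, finDimCover_isRFDCStar hA, fun _ hC _ =>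
    (finDimCover_finDimDominates hA).below hC⟩

/-- `R` lies below `finDimCover`, which is an RFD cover, so maximality puts `finDimCover` below `R`;
domination passes along. -/
theorem IsRFDMax.finDimDominates (hA : IsRFD A) {R : CStarCover A} (hR : R.IsRFDMax) :
    R.FinDimDominates := by
  intro r hr ρ hρ t
  exact (finDimCover_finDimDominates hA r hr ρ hρ t).trans
    (below_iff.1 (hR.2 _ (finDimCover_isRFDCStar hA)
      ((finDimCover_finDimDominates hA).below hR.1)) t)

theorem FinDimDominates.norm_eval_le {R : CStarCover A} (hR : R.FinDimDominates) {K : Type*}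
    [NormedAddCommGroup K] [InnerProductSpace ℂ K] [CompleteSpace K] [FiniteDimensional ℂ K]
    (M : CStarCover A) (φ : M.alg →⋆ₙₐ[ℂ] (K →L[ℂ] K))
    (t : StarTerm A) : ‖t.eval fun a => φ (M.emb a)‖ ≤ ‖t.eval R.ι‖ := by
  -- Domination concerns the spaces `ℂ^r` with `r > 0`: the zero space is treated apart, and any
  -- other is identified with `ℂ^r` by an orthonormal basis.
  rcases Nat.eq_zero_or_pos (Module.finrank ℂ K) with h0 | h0
  · have := Module.finrank_zero_iff.1 h0
    have : t.eval (fun a => φ (M.emb a)) = 0 :=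
      ContinuousLinearMap.ext fun x => Subsingleton.elim _ _
    rw [this, norm_zero]
    exact norm_nonneg _
  · let e : (K →L[ℂ] K) →⋆ₙₐ[ℂ] (EuclideanSpace ℂ (Fin (Module.finrank ℂ K)) →L[ℂ]
        EuclideanSpace ℂ (Fin (Module.finrank ℂ K))) :=
      NonUnitalStarAlgHomClass.toNonUnitalStarAlgHom (stdOrthonormalBasis ℂ K).repr.conjStarAlgEquiv
    have he : Function.Injective e := (stdOrthonormalBasis ℂ K).repr.conjStarAlgEquiv.injective
    have := hR _ h0 (M.restrict (e.comp φ)) (M.restrict_isCompletelyContractive (e.comp φ)) t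
    rw [← NonUnitalStarAlgHom.norm_map e he, StarTerm.map_eval]
    exact this

end CStarCover

end Reps

end

end OpAlg

namespace OpAlg

noncomputable section

open scoped InnerProductSpace
open Filter Topology

/-! ### Finite-dimensional representations -/

section FinDim

/-- The restriction of a `*`-representation to a closed invariant subspace. -/
def restrictRep {B K : Type*} [NonUnitalCStarAlgebra B] [NormedAddCommGroup K]
    [InnerProductSpace ℂ K] [CompleteSpace K] (φ : B →⋆ₙₐ[ℂ] (K →L[ℂ] K)) (W : Submodule ℂ K)
    [CompleteSpace W] (hW : ∀ b, ∀ x ∈ W, φ b x ∈ W) : B →⋆ₙₐ[ℂ] (W →L[ℂ] W) where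
  toFun b := ((φ b).comp W.subtypeL).codRestrict W fun x => hW b x x.2
  map_smul' c b := by ext x; exact congrArg (fun T => T (x : K)) (map_smul φ c b)
  map_zero' := by ext x; exact congrArg (fun T => T (x : K)) (map_zero φ)
  map_add' a b := by ext x; exact congrArg (fun T => T (x : K)) (map_add φ a b)
  map_mul' a b := by ext x; exact congrArg (fun T => T (x : K)) (map_mul φ a b)
  map_star' b := by
    rw [ContinuousLinearMap.star_eq_adjoint, ContinuousLinearMap.eq_adjoint_iff]
    intro x y
    change ⟪φ (star b) x, (y : K)⟫_ℂ = ⟪(x : K), φ b y⟫_ℂ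
    rw [map_star, ContinuousLinearMap.star_eq_adjoint, ContinuousLinearMap.adjoint_inner_left]

theorem restrictRep_apply {B K : Type*} [NonUnitalCStarAlgebra B] [NormedAddCommGroup K]
    [InnerProductSpace ℂ K] [CompleteSpace K] (φ : B →⋆ₙₐ[ℂ] (K →L[ℂ] K)) (W : Submodule ℂ K)
    [CompleteSpace W] (hW : ∀ b, ∀ x ∈ W, φ b x ∈ W) (b : B) (x : W) :
    (restrictRep φ W hW b x : K) = φ b x := rfl

/-- The elements of a `C*`-algebra that are nonzero in some finite-dimensional representation are
nonzero in some irreducible one. -/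
theorem exists_irrep_of_apply_ne_zero' {B K : Type u} [NonUnitalCStarAlgebra B]
    [NormedAddCommGroup K] [InnerProductSpace ℂ K] [CompleteSpace K] [FiniteDimensional ℂ K]
    (φ : B →⋆ₙₐ[ℂ] (K →L[ℂ] K)) {b : B} (hb : φ b ≠ 0) :
    ∃ π : Irrep B, FiniteDimensional ℂ π.K ∧ π.rep b ≠ 0 := by
  -- Minimality is taken among the invariant subspaces on which `b` acts nontrivially; a minimal
  -- nonzero invariant subspace could be annihilated by `b`.
  let P : Submodule ℂ K → Prop := fun W => (∀ c, ∀ x ∈ W, φ c x ∈ W) ∧ ∃ x ∈ W, φ b x ≠ 0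
  have hP : ∃ W, P W := by
    refine ⟨⊤, fun _ _ _ => trivial, ?_⟩
    by_contra! h
    exact hb (ContinuousLinearMap.ext fun x => h x trivial)
  obtain ⟨W, hW⟩ := exists_minimal_of_wellFoundedLT P hP
  obtain ⟨⟨hinv, x, hxW, hx⟩, hmin⟩ := hW
  have hlt : ∀ V ≤ W, (∀ c, ∀ x ∈ V, φ c x ∈ V) → V ≠ W → ∀ y ∈ V, φ b y = 0 := by
    intro V hV hVinv hne y hy
    by_contra h
    exact hne (le_antisymm hV (hmin ⟨hVinv, y, hy, h⟩ hV))
  have hne : restrictRep φ W hinv b ≠ 0 := by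
    intro h
    apply hx
    rw [← restrictRep_apply φ W hinv b ⟨x, hxW⟩, h]
    rfl
  refine ⟨⟨W, restrictRep φ W hinv, ?_, ?_⟩, (inferInstance : FiniteDimensional ℂ W), hne⟩
  · rintro h
    rw [h] at hne
    exact hne rfl
  · intro V _ hVinv
    by_contra! hV
    -- A nontrivial invariant `V'` and its orthogonal complement in `W` are both proper, so by
    -- minimality `φ b` vanishes on each, hence at `x`.
    let V' : Submodule ℂ K := V.map W.subtype
    have hV'W : V' ≤ W := Submodule.map_subtype_le W V
    have hV'inv : ∀ c, ∀ x ∈ V', φ c x ∈ V' := by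
      rintro c _ ⟨y, hy, rfl⟩
      exact ⟨restrictRep φ W hinv c y, hVinv c y hy, rfl⟩
    have h1 := hlt V' hV'W hV'inv (by
      intro h
      apply hV.2
      rw [eq_top_iff]
      rintro ⟨y, hy⟩ -
      rw [← h] at hy
      obtain ⟨z, hz, rfl⟩ := hy
      exact hz)
    have h2 := hlt (W ⊓ V'ᗮ) inf_le_left (by
      rintro c y ⟨hyW, hyV⟩
      refine ⟨hinv c y hyW, fun z hz => ?_⟩
      rw [← ContinuousLinearMap.adjoint_inner_left, ← ContinuousLinearMap.star_eq_adjoint,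
        ← map_star]
      exact hyV _ (hV'inv (star c) z hz)) (by
      intro h
      apply hV.1
      rw [eq_bot_iff]
      intro y hy
      have hy1 : (y : K) ∈ V' := ⟨y, hy, rfl⟩
      have hy2 : (y : K) ∈ V'ᗮ := (h.symm ▸ y.2 : (y : K) ∈ W ⊓ V'ᗮ).2
      have := hy2 _ hy1
      rw [inner_self_eq_zero] at this
      exact Subtype.ext this)
    apply hx
    have hp : V'.starProjection x ∈ V' := Submodule.starProjection_apply_mem _ _
    rw [← add_sub_cancel (V'.starProjection x) x, map_add, h1 _ hp, h2 _ ⟨W.sub_mem hxW (hV'W hp),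
      Submodule.sub_starProjection_mem_orthogonal _⟩, add_zero]

/-- `Irrep B` requires a space in `Type u`, so `K` is replaced by a coordinate space over a lifted
finite index set. -/
theorem exists_irrep_of_apply_ne_zero {B : Type u} {K : Type*} [NonUnitalCStarAlgebra B]
    [NormedAddCommGroup K] [InnerProductSpace ℂ K] [CompleteSpace K] [FiniteDimensional ℂ K]
    (φ : B →⋆ₙₐ[ℂ] (K →L[ℂ] K)) {b : B} (hb : φ b ≠ 0) :
    ∃ π : Irrep B, FiniteDimensional ℂ π.K ∧ π.rep b ≠ 0 := by
  let e := ((stdOrthonormalBasis ℂ K).reindex Equiv.ulift.{u}.symm).repr.conjStarAlgEquiv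
  refine exists_irrep_of_apply_ne_zero'
    ((NonUnitalStarAlgHomClass.toNonUnitalStarAlgHom e).comp φ) (b := b) fun h => hb ?_
  exact e.injective (h.trans (map_zero e).symm)

/-- A finite-dimensional representation takes some element to a unit for its range. -/
theorem exists_unit_of_finiteDimensional {J K : Type*} [NonUnitalCStarAlgebra J]
    [NormedAddCommGroup K] [InnerProductSpace ℂ K] [CompleteSpace K] [FiniteDimensional ℂ K]
    (φ : J →⋆ₙₐ[ℂ] (K →L[ℂ] K)) : ∃ u : J, ∀ j, φ (u * j) = φ j ∧ φ (j * u) = φ j := by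
  let _ := CStarAlgebra.spectralOrder J
  have := CStarAlgebra.spectralOrderedRing J
  have := FiniteDimensional.proper ℂ (K →L[ℂ] K)
  have hl := CStarAlgebra.increasingApproximateUnit J
  -- The image of an approximate unit stays in a compact ball, so it converges along an ultrafilter;
  -- the limit lies in the closed range of `φ` and is a unit there.
  let 𝒰 : Ultrafilter J := Ultrafilter.of (CStarAlgebra.approximateUnit J)
  have h𝒰 : (𝒰 : Filter J) ≤ CStarAlgebra.approximateUnit J := Ultrafilter.of_le _
  have hball : ∀ᶠ x in (𝒰 : Filter J), φ x ∈ Metric.closedBall (0 : K →L[ℂ] K) 1 := by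
    filter_upwards [h𝒰 hl.closedBall_mem] with x hx
    rw [mem_closedBall_zero_iff] at hx ⊢
    exact (NonUnitalStarAlgHom.norm_apply_le φ x).trans hx
  obtain ⟨e, -, he⟩ := (isCompact_closedBall (0 : K →L[ℂ] K) 1).ultrafilter_le_nhds (𝒰.map φ)
    (le_principal_iff.2 hball)
  have he' : Tendsto φ 𝒰 (𝓝 e) := he
  obtain ⟨u, rfl⟩ : e ∈ Set.range φ :=
    (isClosed_range_starHom φ).mem_of_tendsto he' (Eventually.of_forall fun x => ⟨x, rfl⟩)
  refine ⟨u, fun j => ⟨?_, ?_⟩⟩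
  · refine tendsto_nhds_unique (f := fun x => φ (x * j)) (l := (𝒰 : Filter J)) ?_
      (((continuous_starHom φ).tendsto j).comp ((hl.tendsto_mul_right j).mono_left h𝒰))
    simp only [map_mul]
    exact he'.mul_const _
  · refine tendsto_nhds_unique (f := fun x => φ (j * x)) (l := (𝒰 : Filter J)) ?_
      (((continuous_starHom φ).tendsto j).comp ((hl.tendsto_mul_left j).mono_left h𝒰))
    simp only [map_mul]
    exact he'.const_mul _

variable {B C : Type*} [NonUnitalCStarAlgebra B] [NonUnitalCStarAlgebra C]

instance (q : B →⋆ₙₐ[ℂ] C) : NonUnitalCStarAlgebra (kerStar q) :=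
  NonUnitalStarSubalgebra.nonUnitalCStarAlgebra (kerStar q)
    (h_closed := isClosed_eq (continuous_starHom q) continuous_const)

/-- A finite-dimensional representation of the kernel of a `*`-homomorphism extends to the whole
algebra. -/
theorem exists_extension_of_kerStar (q : B →⋆ₙₐ[ℂ] C) {K : Type*}
    [NormedAddCommGroup K] [InnerProductSpace ℂ K] [CompleteSpace K] [FiniteDimensional ℂ K]
    (φ : kerStar q →⋆ₙₐ[ℂ] (K →L[ℂ] K)) :
    ∃ π : B →⋆ₙₐ[ℂ] (K →L[ℂ] K), ∀ j : kerStar q, π j = φ j := by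
  obtain ⟨u, hu⟩ := exists_unit_of_finiteDimensional φ
  have hq : ∀ j : kerStar q, q j = 0 := fun j => j.2
  let l : B → kerStar q → kerStar q := fun b j =>
    ⟨b * j, show q (b * j) = 0 by rw [map_mul, hq, mul_zero]⟩
  let r : kerStar q → B → kerStar q := fun j b =>
    ⟨j * b, show q (j * b) = 0 by rw [map_mul, hq, zero_mul]⟩
  -- The extension will be `b ↦ φ (b u)`. As `u` acts as a unit under `φ`, the elements `b u` and `u
  -- b` have the same image, and `φ (a b u) = φ (u a b u) = φ (a u) φ (b u)`.
  have key : ∀ j b, φ (r u b * j) = φ (l b j) := fun j b => by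
    rw [← (hu (l b j)).1]
    exact congrArg φ (Subtype.ext (mul_assoc _ _ _))
  have hlr : ∀ b, φ (l b u) = φ (r u b) := fun b => by rw [← key, (hu _).2]
  refine ⟨{ toFun := fun b => φ (l b u), map_smul' := ?_, map_zero' := ?_, map_add' := ?_,
            map_mul' := ?_, map_star' := ?_ }, fun j => (hu j).2⟩
  · intro c b
    rw [MonoidHom.id_apply, ← map_smul]
    exact congrArg φ (Subtype.ext (smul_mul_assoc c b (u : B)))
  · rw [← map_zero φ]
    exact congrArg φ (Subtype.ext (zero_mul (u : B)))
  · intro a b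
    rw [← map_add]
    exact congrArg φ (Subtype.ext (add_mul a b (u : B)))
  · intro a b
    rw [hlr a, ← map_mul, hlr (a * b)]
    trans φ (r (r u a) b * u)
    · rw [(hu _).2]
      exact congrArg φ (Subtype.ext (mul_assoc _ _ _).symm)
    · exact congrArg φ (Subtype.ext (mul_assoc _ _ _))
  · intro b
    -- `star u` is a left unit under `φ` too; both sides then become the image of `u* b* u`.
    have h1 : ∀ j, φ (star u * j) = φ j := fun j => by
      rw [← star_star j, ← star_mul, map_star, (hu (star j)).2, ← map_star]
    rw [← map_star, ← h1 (l (star b) u), ← (hu (star (l b u))).2]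
    refine congrArg φ (Subtype.ext ?_)
    change star (u : B) * (star b * u) = star (b * (u : B)) * u
    rw [star_mul, mul_assoc]

theorem kerStar_hom_eq_zero (q : B →⋆ₙₐ[ℂ] C) {K : Type*}
    [NormedAddCommGroup K] [InnerProductSpace ℂ K] [CompleteSpace K] [FiniteDimensional ℂ K]
    (φ : kerStar q →⋆ₙₐ[ℂ] (K →L[ℂ] K))
    (h : ∀ (π : B →⋆ₙₐ[ℂ] (K →L[ℂ] K)) (b : B), q b = 0 → π b = 0) : φ = 0 := by
  obtain ⟨π, hπ⟩ := exists_extension_of_kerStar q φ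
  exact NonUnitalStarAlgHom.ext fun j => (hπ j).symm.trans (h π j j.2)

end FinDim

/-! ### The spectrum of a quotient -/

section Spectrum

variable {B : Type u} [NonUnitalCStarAlgebra B]

theorem isClosed_primitiveIdeals_iff {Z : Set (PrimitiveIdeals B)} :
    IsClosed Z ↔ ∃ S : Set B, Z = hull S := by
  rw [← isOpen_compl_iff]
  change Zᶜᶜ ∈ {Z | ∃ S : Set B, Z = hull S} ↔ _
  rw [compl_compl]
  rfl

/-- Purely topological: a set with a dense subset of finite-dimensional classes lies in the closure
of all such classes. -/
theorem isGreatest_closure_finDimClasses :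
    IsGreatest {C : Set (Spec B) | IsClosed C ∧ HasDenseFinDim C} (closure (finDimClasses B)) := by
  refine ⟨⟨isClosed_closure, finDimClasses B, subset_closure, subset_rfl, subset_rfl⟩, ?_⟩
  rintro C ⟨-, D, -, hD, hCD⟩
  exact hCD.trans (closure_mono hD)

theorem eq_closure_finDimClasses_of_maximal {C : Set (Spec B)}
    (hC : Maximal (fun C' : Set (Spec B) => IsClosed C' ∧ HasDenseFinDim C') C) :
    C = closure (finDimClasses B) :=
  hC.eq_of_le isGreatest_closure_finDimClasses.1 (isGreatest_closure_finDimClasses.2 hC.1)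

theorem exists_factor {C D : Type*} [NonUnitalCStarAlgebra C] [NonUnitalCStarAlgebra D]
    {q : B →⋆ₙₐ[ℂ] C} (hq : Function.Surjective q) {π : B →⋆ₙₐ[ℂ] D}
    (h : ∀ b, q b = 0 → π b = 0) : ∃ σ : C →⋆ₙₐ[ℂ] D, π = σ.comp q := by
  have h' : ∀ a b, q a = q b → π a = π b := fun a b hab => by
    rw [← sub_eq_zero, ← map_sub]
    exact h _ (by rw [map_sub, hab, sub_self])
  -- Any set-theoretic section works, since `π` is constant on the fibres of `q`.
  let s := Function.surjInv hq
  have hs : ∀ c, q (s c) = c := Function.surjInv_eq hq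
  refine ⟨{ toFun := fun c => π (s c), map_smul' := ?_, map_zero' := ?_, map_add' := ?_,
            map_mul' := ?_, map_star' := ?_ }, ?_⟩
  · intro c x
    rw [MonoidHom.id_apply, ← map_smul]
    exact h' _ _ (by simp only [map_smul, hs])
  · exact h _ (hs 0)
  · intro x y
    rw [← map_add]
    exact h' _ _ (by simp only [map_add, hs])
  · intro x y
    rw [← map_mul]
    exact h' _ _ (by simp only [map_mul, hs])
  · intro x
    rw [← map_star]
    exact h' _ _ (by simp only [map_star, hs])
  · ext1 b
    exact h' _ _ (hs _).symm

variable {H : Type u} [NormedAddCommGroup H] [InnerProductSpace ℂ H]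
  {A : NonUnitalSubalgebra ℂ (H →L[ℂ] H)} {M R : CStarCover A}

namespace CStarCover

/-- An irreducible representation factors through the surjection `q` exactly when it kills `ker q`;
the factor has the same range, so it is again irreducible. -/
theorem mem_spectrumIn_iff {q : M.alg →⋆ₙₐ[ℂ] R.alg} (hq : Function.Surjective q)
    (x : Spec M.alg) : x ∈ spectrumIn q ↔ Spec.ker x ∈ hull {b | q b = 0} := by
  constructor
  · rintro ⟨π, rfl, σ, -, hσ⟩ b hb
    change b ∈ TwoSidedIdeal.ker π.rep
    rw [TwoSidedIdeal.mem_ker, hσ]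
    have : q b = 0 := hb
    rw [NonUnitalStarAlgHom.comp_apply, this, map_zero]
  · induction x using Quotient.inductionOn with | _ π =>
    intro h
    have h' : ∀ b, q b = 0 → π.rep b = 0 := fun b hb => (TwoSidedIdeal.mem_ker _).1 (h b hb)
    obtain ⟨σ, hσ⟩ := exists_factor hq h'
    refine ⟨π, rfl, σ, ⟨?_, fun W hWc hW => ?_⟩, hσ⟩
    · rintro rfl
      apply π.irreducible.1
      rw [hσ]
      rfl
    · refine π.irreducible.2 W hWc fun b x hx => ?_
      rw [hσ]
      exact hW _ x hx

theorem isClosed_spectrumIn {q : M.alg →⋆ₙₐ[ℂ] R.alg} (hq : Function.Surjective q) :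
    IsClosed (spectrumIn q) :=
  isClosed_induced_iff.2 ⟨_, isClosed_primitiveIdeals_iff.2 ⟨{b | q b = 0}, rfl⟩,
    Set.ext fun x => (mem_spectrumIn_iff hq x).symm⟩

/-- The kernel of the quotient onto the RFD-maximal cover is annihilated by the finite-dimensional
representations of the maximal cover. -/
theorem FinDimDominates.apply_eq_zero (hR : R.FinDimDominates) (q : M.alg →⋆ₙₐ[ℂ] R.alg)
    (hq : ∀ a, q (M.emb a) = R.emb a) {K : Type*} [NormedAddCommGroup K] [InnerProductSpace ℂ K]
    [CompleteSpace K] [FiniteDimensional ℂ K] (φ : M.alg →⋆ₙₐ[ℂ] (K →L[ℂ] K)) {b : M.alg}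
    (hb : q b = 0) : φ b = 0 := by
  obtain ⟨σ, hσ⟩ := R.exists_hom (hR.norm_eval_le M φ)
  have : φ = σ.comp q := hom_ext fun a => by
    rw [NonUnitalStarAlgHom.comp_apply, hq, hσ]
  rw [this, NonUnitalStarAlgHom.comp_apply, hb, map_zero]

theorem FinDimDominates.kerStar_eq_zero (hR : R.FinDimDominates) (q : M.alg →⋆ₙₐ[ℂ] R.alg)
    (hq : ∀ a, q (M.emb a) = R.emb a) {K : Type*} [NormedAddCommGroup K] [InnerProductSpace ℂ K]
    [CompleteSpace K] [FiniteDimensional ℂ K] (φ : kerStar q →⋆ₙₐ[ℂ] (K →L[ℂ] K)) : φ = 0 := by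
  exact kerStar_hom_eq_zero q φ fun π b hb => hR.apply_eq_zero q hq π hb

theorem FinDimDominates.spectrumIn_eq (hR : R.FinDimDominates) (hRFD : IsRFDCStar R.alg)
    {q : M.alg →⋆ₙₐ[ℂ] R.alg} (hqs : Function.Surjective q) (hq : ∀ a, q (M.emb a) = R.emb a) :
    spectrumIn q = closure (finDimClasses M.alg) := by
  apply Set.Subset.antisymm
  · intro x hx
    rw [mem_spectrumIn_iff hqs] at hx
    rintro Z ⟨hZ, hsub⟩
    obtain ⟨_, hT, rfl⟩ := isClosed_induced_iff.1 hZ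
    obtain ⟨S, rfl⟩ := isClosed_primitiveIdeals_iff.1 hT
    -- The closed set is the preimage of the hull of `S`, so `S ⊆ ker q` is enough. If `q b ≠ 0`, a
    -- matrix representation of the RFD algebra `R.alg` detects it, and then so does a
    -- finite-dimensional irreducible `π`; but `π` lies in that hull and kills `b`.
    intro b hb
    refine hx b ?_
    obtain ⟨Λ, r, τ, -, hτ⟩ := hRFD
    refine hτ _ fun l => ?_
    by_contra hne
    obtain ⟨π, hfin, hπ⟩ := exists_irrep_of_apply_ne_zero ((τ l).comp q) hne
    exact hπ ((TwoSidedIdeal.mem_ker _).1 (hsub ⟨π, hfin, rfl⟩ b hb))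
  · refine closure_minimal ?_ (isClosed_spectrumIn hqs)
    rintro _ ⟨π, _, rfl⟩
    rw [mem_spectrumIn_iff hqs]
    intro b hb
    exact (TwoSidedIdeal.mem_ker _).2 (hR.apply_eq_zero q hq π.rep hb)

/-- The universal property applied to `R.ι` gives a map into all of `B(R.K)`; passing through
seminorms corrects the codomain and yields surjectivity. -/
theorem IsMax.exists_quotient (hM : M.IsMax) (R : CStarCover A) :
    ∃ q : M.alg →⋆ₙₐ[ℂ] R.alg, Function.Surjective q ∧ (∀ a, q (M.emb a) = R.emb a) := by
  obtain ⟨θ, hθ, -⟩ := hM R.K R.ι R.isometric.isCompletelyContractive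
  exact below_iff.2 (M.norm_eval_le hθ)

end CStarCover

end Spectrum

end

end OpAlg

theorem theorem4p4 {H : Type u} [NormedAddCommGroup H] [InnerProductSpace ℂ H] [CompleteSpace H]
    (A : NonUnitalSubalgebra ℂ (H →L[ℂ] H)) (hA : IsRFD A) :
    -- the maximal and the RFD-maximal covers exist
    (∃ M : CStarCover A, M.IsMax) ∧ (∃ R : CStarCover A, R.IsRFDMax) ∧
    ∀ M R : CStarCover A, M.IsMax → R.IsRFDMax →
      ∃ q : M.alg →⋆ₙₐ[ℂ] R.alg,
        Function.Surjective q ∧ (∀ a : A, q (M.emb a) = R.emb a) ∧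
        (∀ q' : M.alg →⋆ₙₐ[ℂ] R.alg, (∀ a : A, q' (M.emb a) = R.emb a) → q' = q) ∧
        -- (i)
        CStarCover.spectrumIn q = closure (finDimClasses M.alg) ∧
        -- (ii)
        (∀ (K : Type u) [NormedAddCommGroup K] [InnerProductSpace ℂ K] [CompleteSpace K]
          [FiniteDimensional ℂ K] (φ : kerStar q →⋆ₙₐ[ℂ] (K →L[ℂ] K)), φ = 0) ∧
        -- (iii)
        IsGreatest {C : Set (Spec M.alg) | IsClosed C ∧ HasDenseFinDim C}
          (CStarCover.spectrumIn q) ∧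
        (∀ C : Set (Spec M.alg),
          Maximal (fun C' : Set (Spec M.alg) => IsClosed C' ∧ HasDenseFinDim C') C →
            C = CStarCover.spectrumIn q) := by
  refine ⟨exists_isMax A, CStarCover.exists_isRFDMax hA, fun M R hM hR => ?_⟩
  have hRd := hR.finDimDominates hA
  refine (hM.exists_quotient R).imp fun q hq => ?_
  have hS := hRd.spectrumIn_eq hR.1 hq.1 hq.2
  refine ⟨hq.1, hq.2, fun q' hq' => CStarCover.hom_ext fun a => (hq' a).trans (hq.2 a).symm, hS,
    fun K _ _ _ _ φ => hRd.kerStar_eq_zero q hq.2 φ, ?_, fun C hC => ?_⟩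
  · rw [hS]
    exact isGreatest_closure_finDimClasses
  · rw [hS]
    exact eq_closure_finDimClasses_of_maximal hC
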